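/- Let $E_0,E_1$ be complex Banach spaces with $E_1$ continuously and densely imbedded into $E_0$, and let $1<p<\infty$, $0<T<\infty$. For an interval $J$ put $Y(J)=L^p(J\to E_1)\cap W^{1,p}(J\to E_0)$; its elements are identified with their continuous $E_0$-valued representatives on $\overline J$. Let $X=(E_0,E_1)_{1-1/p,\,p}=\{u(0): u\in Y(0,\infty)\}$ be the trace space, with the norm $\|x\|_X=\inf\{\|u\|_{L^p((0,\infty)\to E_1)}+\|u'\|_{L^p((0,\infty)\to E_0)} : u\in Y(0,\infty),\ u(0)=x\}$, and write $\overline B_R(x)$ for the closed balls of $X$. Let $\mathrm{MR}_p$ be the set of all $B\in\mathcal L(E_1\to E_0)$ which, as operators in $E_0$ with domain $E_1$, generate a holomorphic semigroup on $E_0$ and for which there is a constant $M>0$ such that, for all $u_0\in X$ and $h\in L^p((0,T)\to E_0)$, the problem $u'-Bu=h$ a.e. in $(0,T)$, $u(0)=u_0$, has a unique solution $u\in Y(0,T)$, and this solution satisfies $\int_0^T\|u'\|_{E_0}^p\,dt+\int_0^T\|Bu\|_{E_0}^p\,dt\le M\bigl(\|u_0\|_X^p+\int_0^T\|h\|_{E_0}^p\,dt\bigr)$.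 Let $g\in L^p((0,T)\to E_0)$, let $U\subset X$ be nonempty and open, and let $A\colon[0,T]\times U\to\mathcal L(E_1\to E_0)$ and $f\colon[0,T]\times U\to E_0$ satisfy * (C1) $A$ is Lipschitz continuous and $A(t,v)\in\mathrm{MR}_p$ for all $(t,v)\in[0,T]\times U$; * (C2) $f$ is Lipschitz continuous. For $0\le a<b\le T$, a *strict solution* on $[a,b]$ with initial value $u_0$ is a function $u\in Y(a,b)$ with $u(a)=u_0$, $u(t)\in U$ for all $t\in[a,b]$, and $u'-A(t,u(t))u(t)=f(t,u(t))+g(t)$ for a.e. $t\in(a,b)$, with all terms in $L^p((a,b)\to E_0)$. Let $w$ be a strict solution on $[0,T]$ with initial value $w_0\in U$, such that $A(t,w(t))\in\mathrm{MR}_p$ for all $t\in[0,T]$. **Theorem.** There are constants $R_0\in(0,\infty)$, $T_1\in(0,T]$ and $L_1\in[1,\infty)$ such that $\overline B_{R_0}(w(t))\subset U$ for all $t\in[0,T]$ and such that, whenever $0\le t_0<t_1\le\min\{t_0+T_1,T\}$: for each $u_0\in\overline B_{R_0}(w(t_0))$ there is a unique strict solution on $[t_0,t_1]$ with initial value $u_0$,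 and any two strict solutions $u_1,u_2$ on $[t_0,t_1]$ with initial values in $\overline B_{R_0}(w(t_0))$ satisfy $\|u_1(t)-u_2(t)\|_X\le L_1\|u_1(t_0)-u_2(t_0)\|_X$ for all $t\in[t_0,t_1]$. Moreover, with $m$ the smallest natural number such that $m\ge T/T_1$ and with $R_m=R_0/L_1^m$: 1. If $t_0\in[0,T)$ and $u_0\in\overline B_{R_m}(w(t_0))$, then there is a unique strict solution $u$ on $[t_0,T]$ with initial value $u_0$; it belongs to $C([t_0,T]\to X)$, and $u(t)\in\overline B_{R_0}(w(t))\subset U$ for every $t\in[t_0,T]$. 2. If $t_0\in[0,T)$ and $u_1,u_2$ are strict solutions on $[t_0,T]$ with initial values $u_{0,1},u_{0,2}\in\overline B_{R_m}(w(t_0))$, then for all $t\in[t_0,T]$ one has $u_1(t),u_2(t)\in\overline B_{R_0}(w(t))\subset U$ and $\|u_1(t)-u_2(t)\|_X\le L_1^m\,\|u_{0,1}-u_{0,2}\|_X$. -/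

import Mathlib

open MeasureTheory Set Filter Topology

/-! ### The spaces `Y = L^p(J → E₁) ∩ W^{1,p}(J → E₀)` and the trace space

Throughout, `ι : E₁ →L[ℂ] E₀` is the imbedding of `E₁` into `E₀`. -/

/-- `u : ℝ → E₀` is (on the closed interval `J`) the continuous representative of an element of
`L^p(J → E₁) ∩ W^{1,p}(J → E₀)`: it agrees a.e. in `J` with the `E₁`-valued function `w ∈ L^p`,
and it is an indefinite integral of its derivative `v ∈ L^p(J → E₀)`. Since `ι` is injective,
`u` determines `w` and `v` up to null sets. -/
structure IsYFun {E₀ E₁ : Type*} [NormedAddCommGroup E₀] [NormedSpace ℂ E₀]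
    [NormedAddCommGroup E₁] [NormedSpace ℂ E₁] (ι : E₁ →L[ℂ] E₀) (p : ℝ) (J : Set ℝ)
    (u : ℝ → E₀) (w : ℝ → E₁) (v : ℝ → E₀) : Prop where
  memLp_fun : MemLp w (ENNReal.ofReal p) (volume.restrict J)
  memLp_deriv : MemLp v (ENNReal.ofReal p) (volume.restrict J)
  ae_eq : ∀ᵐ t ∂(volume.restrict J), u t = ι (w t)
  sub_eq : ∀ t₁ ∈ J, ∀ t₂ ∈ J, u t₂ - u t₁ = ∫ s in t₁..t₂, v s

section TraceSpace

variable {E₀ E₁ : Type*} [NormedAddCommGroup E₀] [NormedSpace ℂ E₀]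
  [NormedAddCommGroup E₁] [NormedSpace ℂ E₁] {ι : E₁ →L[ℂ] E₀} {p : ℝ}

theorem one_le_ofReal_of_fact [hp : Fact (1 < p)] : (1 : ENNReal) ≤ ENNReal.ofReal p := by
  simpa using ENNReal.ofReal_le_ofReal hp.out.le

theorem intervalIntegrable_of_memLp_Ici [Fact (1 < p)] {F : Type*} [NormedAddCommGroup F]
    {v : ℝ → F}
    (hv : MemLp v (ENNReal.ofReal p) (volume.restrict (Ici 0))) {t₁ t₂ : ℝ}
    (h₁ : t₁ ∈ Ici (0 : ℝ)) (h₂ : t₂ ∈ Ici (0 : ℝ)) :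
    IntervalIntegrable v volume t₁ t₂ := by
  rw [intervalIntegrable_iff]
  have hsub : uIoc t₁ t₂ ⊆ Ici (0 : ℝ) := fun x hx =>
    (le_min h₁ h₂).trans (hx.1.le)
  have h := hv.mono_measure (Measure.restrict_mono_set volume hsub)
  have : IsFiniteMeasure (volume.restrict (uIoc t₁ t₂)) :=
    ⟨by simp [uIoc]⟩
  exact h.integrable one_le_ofReal_of_fact

theorem IsYFun.zero {J : Set ℝ} :
    IsYFun ι p J (fun _ => 0) (fun _ => 0) (fun _ => 0) :=
  ⟨MemLp.zero, MemLp.zero, by simp, by simp⟩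

theorem IsYFun.add [Fact (1 < p)] {u u' v v' : ℝ → E₀} {w w' : ℝ → E₁}
    (h : IsYFun ι p (Ici 0) u w v) (h' : IsYFun ι p (Ici 0) u' w' v') :
    IsYFun ι p (Ici 0) (u + u') (w + w') (v + v') where
  memLp_fun := h.memLp_fun.add h'.memLp_fun
  memLp_deriv := h.memLp_deriv.add h'.memLp_deriv
  ae_eq := by
    filter_upwards [h.ae_eq, h'.ae_eq] with t ht ht'
    simp [ht, ht']
  sub_eq t₁ h₁ t₂ h₂ := by
    simp only [Pi.add_apply]
    rw [intervalIntegral.integral_add (intervalIntegrable_of_memLp_Ici h.memLp_deriv h₁ h₂)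
      (intervalIntegrable_of_memLp_Ici h'.memLp_deriv h₁ h₂), ← h.sub_eq t₁ h₁ t₂ h₂,
      ← h'.sub_eq t₁ h₁ t₂ h₂]
    abel

theorem IsYFun.smul {J : Set ℝ} {u v : ℝ → E₀} {w : ℝ → E₁} (c : ℂ)
    (h : IsYFun ι p J u w v) : IsYFun ι p J (c • u) (c • w) (c • v) where
  memLp_fun := h.memLp_fun.const_smul c
  memLp_deriv := h.memLp_deriv.const_smul c
  ae_eq := by
    filter_upwards [h.ae_eq] with t ht
    simp [ht]
  sub_eq t₁ h₁ t₂ h₂ := by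
    simp only [Pi.smul_apply]
    rw [intervalIntegral.integral_smul, ← h.sub_eq t₁ h₁ t₂ h₂, smul_sub]

variable (ι p)

/-- The real interpolation space `(E₀, E₁)_{1 - 1/p, p}` (trace method), as a vector space: the
initial values `u(0)` of the functions `u ∈ L^p(ℝ₊ → E₁) ∩ W^{1,p}(ℝ₊ → E₀)`. -/
def traceSubmodule [Fact (1 < p)] : Submodule ℂ E₀ where
  carrier := {x | ∃ u w v, IsYFun ι p (Ici 0) u w v ∧ u 0 = x}
  zero_mem' := ⟨_, _, _, IsYFun.zero, rfl⟩
  add_mem' := by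
    rintro _ _ ⟨u, w, v, h, rfl⟩ ⟨u', w', v', h', rfl⟩
    exact ⟨_, _, _, h.add h', rfl⟩
  smul_mem' := by
    rintro c _ ⟨u, w, v, h, rfl⟩
    exact ⟨_, _, _, h.smul c, rfl⟩

/-- The trace space `(E₀, E₁)_{1 - 1/p, p}`. It carries the trace norm defined below (and not the
norm induced by `E₀`). -/
def TraceSpace [Fact (1 < p)] : Type _ := traceSubmodule ι p

instance [Fact (1 < p)] : AddCommGroup (TraceSpace ι p) :=
  inferInstanceAs (AddCommGroup (traceSubmodule ι p))

instance [Fact (1 < p)] : Module ℂ (TraceSpace ι p) :=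
  inferInstanceAs (Module ℂ (traceSubmodule ι p))

/-- The inclusion of the trace space into `E₀`. -/
def TraceSpace.incl [Fact (1 < p)] : TraceSpace ι p →ₗ[ℂ] E₀ := (traceSubmodule ι p).subtype

/-- The values of the norm `‖w‖_{L^p(ℝ₊ → E₁)} + ‖v‖_{L^p(ℝ₊ → E₀)}`, `v = u'`, of those
functions in `L^p(ℝ₊ → E₁) ∩ W^{1,p}(ℝ₊ → E₀)` whose initial value is `x`. -/
def traceNormSet (x : E₀) : Set ℝ :=
  {r | ∃ u w v, IsYFun ι p (Ici 0) u w v ∧ u 0 = x ∧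
    r = (eLpNorm w (ENNReal.ofReal p) (volume.restrict (Ici 0))).toReal
      + (eLpNorm v (ENNReal.ofReal p) (volume.restrict (Ici 0))).toReal}

/-- The trace norm: the infimum of the norms of the functions with initial value `x`. -/
noncomputable instance [Fact (1 < p)] : Norm (TraceSpace ι p) :=
  ⟨fun x => sInf (traceNormSet ι p (TraceSpace.incl ι p x))⟩

variable {ι p}

theorem TraceSpace.norm_def [Fact (1 < p)] (x : TraceSpace ι p) :
    ‖x‖ = sInf (traceNormSet ι p (TraceSpace.incl ι p x)) := rfl

theorem traceNormSet_nonneg {x : E₀} {r : ℝ} (hr : r ∈ traceNormSet ι p x) : 0 ≤ r := by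
  obtain ⟨u, w, v, -, -, rfl⟩ := hr
  positivity

theorem traceNormSet_bddBelow (x : E₀) : BddBelow (traceNormSet ι p x) :=
  ⟨0, fun _ hr => traceNormSet_nonneg hr⟩

theorem TraceSpace.traceNormSet_nonempty [Fact (1 < p)] (x : TraceSpace ι p) :
    (traceNormSet ι p (TraceSpace.incl ι p x)).Nonempty := by
  obtain ⟨u, w, v, h, hx⟩ := x.2
  exact ⟨_, u, w, v, h, hx, rfl⟩

theorem traceNormSet_smul {x : E₀} {r : ℝ} (c : ℂ) (hr : r ∈ traceNormSet ι p x) :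
    ‖c‖ * r ∈ traceNormSet ι p (c • x) := by
  obtain ⟨u, w, v, h, rfl, rfl⟩ := hr
  refine ⟨_, _, _, h.smul c, rfl, ?_⟩
  simp [eLpNorm_const_smul, ENNReal.toReal_mul, mul_add]

theorem toReal_eLpNorm_add_le [Fact (1 < p)] {F : Type*} [NormedAddCommGroup F] {a b : ℝ → F}
    (ha : MemLp a (ENNReal.ofReal p) (volume.restrict (Ici (0 : ℝ))))
    (hb : MemLp b (ENNReal.ofReal p) (volume.restrict (Ici (0 : ℝ)))) :
    (eLpNorm (a + b) (ENNReal.ofReal p) (volume.restrict (Ici 0))).toReal ≤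
      (eLpNorm a (ENNReal.ofReal p) (volume.restrict (Ici 0))).toReal +
      (eLpNorm b (ENNReal.ofReal p) (volume.restrict (Ici 0))).toReal := by
  rw [← ENNReal.toReal_add ha.eLpNorm_ne_top hb.eLpNorm_ne_top]
  exact ENNReal.toReal_mono (ENNReal.add_ne_top.2 ⟨ha.eLpNorm_ne_top, hb.eLpNorm_ne_top⟩)
    (eLpNorm_add_le ha.1 hb.1 one_le_ofReal_of_fact)

theorem traceNormSet_add [Fact (1 < p)] {x y : E₀} {r s : ℝ} (hr : r ∈ traceNormSet ι p x)
    (hs : s ∈ traceNormSet ι p y) : ∃ q ∈ traceNormSet ι p (x + y), q ≤ r + s := by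
  obtain ⟨u, w, v, h, rfl, rfl⟩ := hr
  obtain ⟨u', w', v', h', rfl, rfl⟩ := hs
  refine ⟨_, ⟨_, _, _, h.add h', rfl, rfl⟩, ?_⟩
  have h₁ := toReal_eLpNorm_add_le h.memLp_fun h'.memLp_fun
  have h₂ := toReal_eLpNorm_add_le h.memLp_deriv h'.memLp_deriv
  linarith

theorem integral_norm_le_toReal_eLpNorm [Fact (1 < p)] {F : Type*} [NormedAddCommGroup F]
    {a : ℝ → F} (ha : MemLp a (ENNReal.ofReal p) (volume.restrict (Ici (0 : ℝ)))) :
    IntegrableOn a (Ioc 0 1) ∧ ∫ t in Ioc (0 : ℝ) 1, ‖a t‖ ≤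
      (eLpNorm a (ENNReal.ofReal p) (volume.restrict (Ici 0))).toReal := by
  have hsub : Ioc (0 : ℝ) 1 ⊆ Ici 0 := fun x hx => hx.1.le
  have hm := Measure.restrict_mono_set (volume : Measure ℝ) hsub
  have h := ha.mono_measure hm
  have : IsProbabilityMeasure (volume.restrict (Ioc (0 : ℝ) 1)) := ⟨by simp⟩
  refine ⟨h.integrable one_le_ofReal_of_fact, ?_⟩
  rw [integral_norm_eq_lintegral_enorm h.1, ← eLpNorm_one_eq_lintegral_enorm]
  exact ENNReal.toReal_mono ha.eLpNorm_ne_top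
    ((eLpNorm_le_eLpNorm_of_exponent_le one_le_ofReal_of_fact h.1).trans
      (eLpNorm_mono_measure a hm))

/-- The trace space is continuously imbedded into `E₀`. -/
theorem norm_le_of_mem_traceNormSet [Fact (1 < p)] {x : E₀} {r : ℝ}
    (hr : r ∈ traceNormSet ι p x) : ‖x‖ ≤ (‖ι‖ + 1) * r := by
  obtain ⟨u, w, v, h, rfl, rfl⟩ := hr
  obtain ⟨hwi, hw⟩ := integral_norm_le_toReal_eLpNorm h.memLp_fun
  obtain ⟨hvi, hv⟩ := integral_norm_le_toReal_eLpNorm h.memLp_deriv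
  set a := (eLpNorm w (ENNReal.ofReal p) (volume.restrict (Ici 0))).toReal
  set b := (eLpNorm v (ENNReal.ofReal p) (volume.restrict (Ici 0))).toReal
  have ha : 0 ≤ a := ENNReal.toReal_nonneg
  have hb : 0 ≤ b := ENNReal.toReal_nonneg
  have hae : ∀ᵐ t ∂(volume.restrict (Ioc (0 : ℝ) 1)), ‖u 0‖ ≤ ‖ι‖ * ‖w t‖ + b := by
    have h1 : ∀ᵐ t ∂(volume.restrict (Ioc (0 : ℝ) 1)), u t = ι (w t) :=
      ae_mono (Measure.restrict_mono_set volume fun x hx => hx.1.le) h.ae_eq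
    filter_upwards [h1, ae_restrict_mem measurableSet_Ioc] with t ht htm
    have h2 := h.sub_eq 0 (by simp) t htm.1.le
    have h3 : ‖∫ s in (0 : ℝ)..t, v s‖ ≤ b := by
      refine (intervalIntegral.norm_integral_le_integral_norm htm.1.le).trans ?_
      rw [intervalIntegral.integral_of_le htm.1.le]
      exact (setIntegral_mono_set hvi.norm (Eventually.of_forall fun _ => norm_nonneg _)
        (Ioc_subset_Ioc_right htm.2).eventuallyLE).trans hv
    have h4 : u 0 = ι (w t) - ∫ s in (0 : ℝ)..t, v s := by
      rw [← ht, ← h2]; abel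
    rw [h4]
    exact (norm_sub_le _ _).trans (add_le_add (ι.le_opNorm _) h3)
  have hint : ∫ _ in Ioc (0 : ℝ) 1, ‖u 0‖ ≤ ∫ t in Ioc (0 : ℝ) 1, (‖ι‖ * ‖w t‖ + b) :=
    integral_mono_ae (by simp) ((hwi.norm.const_mul _).add (by simp)) hae
  rw [integral_add (hwi.norm.const_mul _) (by simp), integral_const_mul] at hint
  simp at hint
  nlinarith [norm_nonneg ι, mul_le_mul_of_nonneg_left hw (norm_nonneg ι),
    mul_nonneg (norm_nonneg ι) hb]

theorem TraceSpace.core [Fact (1 < p)] : NormedSpace.Core ℂ (TraceSpace ι p) where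
  norm_nonneg x := Real.sInf_nonneg fun _ hr => traceNormSet_nonneg hr
  norm_smul c x := by
    have key : ∀ (c : ℂ) (x : TraceSpace ι p), ‖c • x‖ ≤ ‖c‖ * ‖x‖ := by
      intro c x
      rw [TraceSpace.norm_def x, ← smul_eq_mul, ← Real.sInf_smul_of_nonneg (norm_nonneg c)]
      refine csInf_le_csInf (traceNormSet_bddBelow _) (x.traceNormSet_nonempty.smul_set) ?_
      rintro _ ⟨r, hr, rfl⟩
      rw [map_smul]
      exact traceNormSet_smul c hr
    refine le_antisymm (key c x) ?_
    rcases eq_or_ne c 0 with rfl | hc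
    · rw [norm_zero, zero_mul]
      exact Real.sInf_nonneg fun _ hr => traceNormSet_nonneg hr
    · have h := key c⁻¹ (c • x)
      rw [inv_smul_smul₀ hc, norm_inv] at h
      rwa [← le_inv_mul_iff₀ (norm_pos_iff.2 hc)]
  norm_triangle x y := by
    refine le_of_forall_pos_le_add fun ε hε => ?_
    obtain ⟨r, hr, hrx⟩ := Real.lt_sInf_add_pos x.traceNormSet_nonempty (half_pos hε)
    obtain ⟨s, hs, hsy⟩ := Real.lt_sInf_add_pos y.traceNormSet_nonempty (half_pos hε)
    obtain ⟨q, hq, hqrs⟩ := traceNormSet_add hr hs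
    have h1 : ‖x + y‖ ≤ q := by
      rw [TraceSpace.norm_def, map_add]
      exact csInf_le (traceNormSet_bddBelow _) hq
    rw [TraceSpace.norm_def x, TraceSpace.norm_def y]
    linarith
  norm_eq_zero_iff x := by
    constructor
    · intro h
      have h0 : ‖TraceSpace.incl ι p x‖ ≤ 0 := by
        refine le_of_forall_pos_le_add fun ε hε => ?_
        have hK : 0 < ‖ι‖ + 1 := by positivity
        obtain ⟨r, hr, hrx⟩ :=
          Real.lt_sInf_add_pos x.traceNormSet_nonempty (div_pos hε hK)
        rw [← TraceSpace.norm_def x, h, zero_add] at hrx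
        have := norm_le_of_mem_traceNormSet hr
        rw [lt_div_iff₀ hK] at hrx
        linarith
      exact Subtype.ext (norm_le_zero_iff.1 h0)
    · rintro rfl
      refine le_antisymm ?_ (Real.sInf_nonneg fun _ hr => traceNormSet_nonneg hr)
      rw [TraceSpace.norm_def, map_zero]
      exact csInf_le (traceNormSet_bddBelow _) ⟨_, _, _, IsYFun.zero, rfl, by simp⟩

noncomputable instance [Fact (1 < p)] : NormedAddCommGroup (TraceSpace ι p) :=
  NormedAddCommGroup.ofCore TraceSpace.core

noncomputable instance [Fact (1 < p)] : NormedSpace ℂ (TraceSpace ι p) :=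
  NormedSpace.ofCore TraceSpace.core

end TraceSpace

/-! ### Strict solutions, generators of holomorphic semigroups, maximal regularity -/

section Evolution

variable {E₀ E₁ : Type*} [NormedAddCommGroup E₀] [NormedSpace ℂ E₀]
  [NormedAddCommGroup E₁] [NormedSpace ℂ E₁]

/-- `u` is a strict solution on `[a, b]` of
`du/dt - A(t, u(t)) u(t) = f(t, u(t)) + g(t)` for a.e. `t ∈ (a, b)`, `u(a) = u₀`:
`u ∈ L^p((a, b) → E₁) ∩ W^{1,p}((a, b) → E₀)`, `u(t) ∈ U` for all `t ∈ [a, b]`, and the equation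
holds with all its terms in `L^p((a, b) → E₀)`. Here `w` is `u` as an `E₁`-valued function and
`v = du/dt`. Only the values of `u` on `[a, b]` matter. -/
def IsStrictSolution (ι : E₁ →L[ℂ] E₀) (p : ℝ) [Fact (1 < p)] (U : Set (TraceSpace ι p))
    (A : ℝ → TraceSpace ι p → E₁ →L[ℂ] E₀) (f : ℝ → TraceSpace ι p → E₀) (g : ℝ → E₀)
    (a b : ℝ) (u₀ : TraceSpace ι p) (u : ℝ → TraceSpace ι p) : Prop :=
  u a = u₀ ∧ (∀ t ∈ Icc a b, u t ∈ U) ∧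
  ∃ (w : ℝ → E₁) (v : ℝ → E₀),
    IsYFun ι p (Icc a b) (fun t => TraceSpace.incl ι p (u t)) w v ∧
    MemLp (fun t => A t (u t) (w t)) (ENNReal.ofReal p) (volume.restrict (Icc a b)) ∧
    MemLp (fun t => f t (u t)) (ENNReal.ofReal p) (volume.restrict (Icc a b)) ∧
    MemLp g (ENNReal.ofReal p) (volume.restrict (Icc a b)) ∧
    ∀ᵐ t ∂(volume.restrict (Icc a b)), v t - A t (u t) (w t) = f t (u t) + g t

/-- The open sector `{z ≠ 0 : |arg z| < δ}`. -/
def openSector (δ : ℝ) : Set ℂ := {z | z ≠ 0 ∧ |z.arg| < δ}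

/-- `B ∈ Hol(E₁ → E₀)`: the operator `B`, regarded as an operator in `E₀` with domain `E₁`, is the
infinitesimal generator of a holomorphic semigroup `S` on `E₀`, i.e. of a semigroup holomorphic in
a sector about the positive real axis and strongly continuous at `0` in that sector. The last
clause says that the graph of the generator of `S` is exactly `{(ι e, B e) : e ∈ E₁}`. -/
def IsHolGenerator (ι B : E₁ →L[ℂ] E₀) : Prop :=
  ∃ δ : ℝ, 0 < δ ∧ δ ≤ Real.pi / 2 ∧ ∃ S : ℂ → E₀ →L[ℂ] E₀,
    DifferentiableOn ℂ S (openSector δ) ∧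
    S 0 = ContinuousLinearMap.id ℂ E₀ ∧
    (∀ z₁ ∈ openSector δ, ∀ z₂ ∈ openSector δ, S (z₁ + z₂) = (S z₁).comp (S z₂)) ∧
    (∀ x : E₀, Tendsto (fun z => S z x) (𝓝[openSector δ] 0) (𝓝 x)) ∧
    ∀ x y : E₀,
      Tendsto (fun t : ℝ => ((t : ℂ)⁻¹) • (S (t : ℂ) x - x)) (𝓝[>] 0) (𝓝 y) ↔
        ∃ e : E₁, ι e = x ∧ B e = y

/-- `B ∈ MR_p(E₁ → E₀)`: `B` generates a holomorphic semigroup on `E₀` with domain `E₁`, and it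
has the maximal `L^p`-regularity property on `(0, T)`: for all `u₀` in the trace space and all
`g ∈ L^p((0, T) → E₀)` there is a unique strict solution of `du/dt - B u = g`, `u(0) = u₀`, and it
satisfies the estimate below with a constant `M` that does not depend on `u₀` and `g`. -/
def MaximalRegularity (ι : E₁ →L[ℂ] E₀) (p : ℝ) [Fact (1 < p)] (T : ℝ) (B : E₁ →L[ℂ] E₀) : Prop :=
  IsHolGenerator ι B ∧
  ∃ M : ℝ, 0 < M ∧ ∀ (u₀ : TraceSpace ι p) (g : ℝ → E₀),
    MemLp g (ENNReal.ofReal p) (volume.restrict (Icc 0 T)) →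
    ∃ u : ℝ → TraceSpace ι p,
      IsStrictSolution ι p univ (fun _ _ => B) (fun _ _ => 0) g 0 T u₀ u ∧
      (∀ u' : ℝ → TraceSpace ι p,
        IsStrictSolution ι p univ (fun _ _ => B) (fun _ _ => 0) g 0 T u₀ u' →
        EqOn u' u (Icc 0 T)) ∧
      ∀ (w : ℝ → E₁) (v : ℝ → E₀),
        IsYFun ι p (Icc 0 T) (fun t => TraceSpace.incl ι p (u t)) w v →
        (∫ t in (0 : ℝ)..T, ‖v t‖ ^ p) + (∫ t in (0 : ℝ)..T, ‖B (w t)‖ ^ p) ≤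
          M * (‖u₀‖ ^ p + ∫ t in (0 : ℝ)..T, ‖g t‖ ^ p)

end Evolution

/-! Subtract the reference solution and freeze the operator at the left end point `a`. If `u` solves
the quasilinear problem, then `d = u - w` solves `d' - A(a, w(a)) d = F(d)`, where `F(d) = A(t,
w+d)(w+d) - A(t, w) w - A(a, w(a)) d + f(t, w+d) - f(t, w)`; the term `g` cancels. On short
intervals `F` has a small Lipschitz constant for small `d`: the operator `A(t, w+d)` is close to
`A(a, w(a))`, and the Lipschitz dependence of `A` on `d` is multiplied by the `L^p` norm of `w` with
values in `E₁`, which is small on short intervals (`LocalFrame.pnorm_frozenRemainder_sub_le`).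

To profit from this, the linear estimate needs one constant `K` for all frozen operators and all
short intervals. The open mapping theorem gives it for zero initial values on `(0, T)`, extension by
zero to the left transfers it to shorter intervals, and an extension of the initial value to the
half line removes the zero condition (`MaximalRegularity.exists_hasMaxRegBound`). The estimate
survives small perturbations of the operator, so compactness of `[0, T]` makes it uniform
(`exists_uniform_hasMaxRegBound`). Sup norms in the trace space are controlled by
`TraceSpace.norm_apply_le`, whose constant does not depend on the interval.

Existence is then a contraction argument (`LocalFrame.exists_diff`). Uniqueness and Lipschitz
dependence for arbitrary strict solutions need also that a solution starting near `w` stays near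
`w`; this is a continuity argument in the right end point (`LocalFrame.a_priori_bound`). Finally the
local result is iterated over steps of length `T₁`. Each step multiplies distances by at most `L₁`,
and since `w` is itself a solution, initial radii `R₀ / L₁ ^ m` suffice to stay within `R₀` of `w`
for `m` steps. -/

/-! ### The `L^p` norm on a set as a real number -/

/-- The norm of `f` in `L^p(J)`, as a real number. -/
noncomputable def pnorm {F : Type*} [NormedAddCommGroup F] (p : ℝ) (J : Set ℝ) (f : ℝ → F) : ℝ :=
  (eLpNorm f (ENNReal.ofReal p) (volume.restrict J)).toReal

section PNorm

variable {F F' : Type*} [NormedAddCommGroup F] [NormedAddCommGroup F'] {p : ℝ} {J J' : Set ℝ}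
  {f g : ℝ → F}

theorem pnorm_nonneg : 0 ≤ pnorm p J f := ENNReal.toReal_nonneg

theorem pnorm_zero : pnorm p J (fun _ => (0 : F)) = 0 := by
  simp [pnorm]

theorem pnorm_congr_ae (h : f =ᵐ[volume.restrict J] g) : pnorm p J f = pnorm p J g := by
  rw [pnorm, pnorm, eLpNorm_congr_ae h]

theorem pnorm_neg : pnorm p J (-f) = pnorm p J f := by
  rw [pnorm, pnorm, eLpNorm_neg]

theorem pnorm_norm : pnorm p J (fun t => ‖f t‖) = pnorm p J f := by
  rw [pnorm, pnorm, eLpNorm_norm]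

theorem pnorm_add_le [Fact (1 < p)] (hf : MemLp f (ENNReal.ofReal p) (volume.restrict J))
    (hg : MemLp g (ENNReal.ofReal p) (volume.restrict J)) :
    pnorm p J (f + g) ≤ pnorm p J f + pnorm p J g := by
  rw [pnorm, pnorm, pnorm, ← ENNReal.toReal_add hf.eLpNorm_ne_top hg.eLpNorm_ne_top]
  exact ENNReal.toReal_mono (ENNReal.add_ne_top.2 ⟨hf.eLpNorm_ne_top, hg.eLpNorm_ne_top⟩)
    (eLpNorm_add_le hf.1 hg.1 one_le_ofReal_of_fact)

theorem pnorm_sub_le [Fact (1 < p)] (hf : MemLp f (ENNReal.ofReal p) (volume.restrict J))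
    (hg : MemLp g (ENNReal.ofReal p) (volume.restrict J)) :
    pnorm p J (f - g) ≤ pnorm p J f + pnorm p J g := by
  rw [sub_eq_add_neg, ← pnorm_neg (f := g)]
  exact pnorm_add_le hf hg.neg

/-- Membership in `L^p` matters here and below because `pnorm` assigns the value `0` to functions of
infinite norm. -/
theorem pnorm_mono_set (hJ : J' ⊆ J) (hf : MemLp f (ENNReal.ofReal p) (volume.restrict J)) :
    pnorm p J' f ≤ pnorm p J f :=
  ENNReal.toReal_mono hf.eLpNorm_ne_top
    (eLpNorm_mono_measure f (Measure.restrict_mono_set volume hJ))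

theorem MeasureTheory.MemLp.restrict_mono_set
    (hf : MemLp f (ENNReal.ofReal p) (volume.restrict J)) (hJ : J' ⊆ J) :
    MemLp f (ENNReal.ofReal p) (volume.restrict J') :=
  hf.mono_measure (Measure.restrict_mono_set volume hJ)

theorem pnorm_le_pnorm {g : ℝ → F'} (hg : MemLp g (ENNReal.ofReal p) (volume.restrict J))
    (h : ∀ᵐ t ∂(volume.restrict J), ‖f t‖ ≤ ‖g t‖) : pnorm p J f ≤ pnorm p J g :=
  ENNReal.toReal_mono hg.eLpNorm_ne_top (eLpNorm_mono_ae h)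

theorem pnorm_const_mul {c : ℝ} (hc : 0 ≤ c) (f : ℝ → ℝ) :
    pnorm p J (fun t => c * f t) = c * pnorm p J f := by
  have : (fun t => c * f t) = c • f := rfl
  rw [pnorm, this, eLpNorm_const_smul, ENNReal.toReal_mul, toReal_enorm, Real.norm_of_nonneg hc,
    pnorm]

theorem pnorm_indicator (hJ : MeasurableSet J) (h : J ⊆ J') :
    pnorm p J' (J.indicator f) = pnorm p J f := by
  rw [pnorm, pnorm, eLpNorm_indicator_eq_eLpNorm_restrict hJ, Measure.restrict_restrict hJ,
    inter_eq_self_of_subset_left h]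

theorem memLp_indicator (hJ : MeasurableSet J) (h : J ⊆ J')
    (hf : MemLp f (ENNReal.ofReal p) (volume.restrict J)) :
    MemLp (J.indicator f) (ENNReal.ofReal p) (volume.restrict J') := by
  rw [memLp_indicator_iff_restrict hJ, Measure.restrict_restrict hJ,
    inter_eq_self_of_subset_left h]
  exact hf

theorem measurePreserving_restrict {φ : ℝ → ℝ} (hφ : MeasurePreserving φ volume volume)
    (hJ : MeasurableSet J) (hJ' : ∀ x, x ∈ J' ↔ φ x ∈ J) :
    MeasurePreserving φ (volume.restrict J') (volume.restrict J) := by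
  have : J' = φ ⁻¹' J := by ext x; exact hJ' x
  rw [this]
  exact hφ.restrict_preimage hJ

theorem pnorm_comp {φ : ℝ → ℝ} (hφ : MeasurePreserving φ volume volume)
    (hJ : MeasurableSet J) (hJ' : ∀ x, x ∈ J' ↔ φ x ∈ J)
    (hf : MemLp f (ENNReal.ofReal p) (volume.restrict J)) :
    pnorm p J' (f ∘ φ) = pnorm p J f := by
  rw [pnorm, pnorm, eLpNorm_comp_measurePreserving hf.1 (measurePreserving_restrict hφ hJ hJ')]

theorem intervalIntegrable_of_memLp [Fact (1 < p)] [hJ : J.OrdConnected]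
    (hf : MemLp f (ENNReal.ofReal p) (volume.restrict J)) {t₁ t₂ : ℝ} (h₁ : t₁ ∈ J)
    (h₂ : t₂ ∈ J) : IntervalIntegrable f volume t₁ t₂ := by
  rw [intervalIntegrable_iff]
  have h := hf.restrict_mono_set (uIoc_subset_uIcc.trans (hJ.uIcc_subset h₁ h₂))
  have : IsFiniteMeasure (volume.restrict (uIoc t₁ t₂)) := ⟨by simp [uIoc]⟩
  exact h.integrable one_le_ofReal_of_fact

end PNorm

/-! ### Calculus in `L^p(J → E₁) ∩ W^{1,p}(J → E₀)` -/

namespace IsYFun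

variable {E₀ E₁ : Type*} [NormedAddCommGroup E₀] [NormedSpace ℂ E₀]
  [NormedAddCommGroup E₁] [NormedSpace ℂ E₁] {ι : E₁ →L[ℂ] E₀} {p : ℝ} {J J' : Set ℝ}
  {u u' v v' : ℝ → E₀} {w w' : ℝ → E₁}

theorem mono (h : IsYFun ι p J u w v) (hJ : J' ⊆ J) : IsYFun ι p J' u w v where
  memLp_fun := h.memLp_fun.restrict_mono_set hJ
  memLp_deriv := h.memLp_deriv.restrict_mono_set hJ
  ae_eq := ae_mono (Measure.restrict_mono_set volume hJ) h.ae_eq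
  sub_eq t₁ h₁ t₂ h₂ := h.sub_eq t₁ (hJ h₁) t₂ (hJ h₂)

theorem congr (h : IsYFun ι p J u w v) (hJ : MeasurableSet J) (hu : EqOn u' u J) :
    IsYFun ι p J u' w v where
  memLp_fun := h.memLp_fun
  memLp_deriv := h.memLp_deriv
  ae_eq := by
    filter_upwards [h.ae_eq, ae_restrict_mem hJ] with t ht htJ
    rw [hu htJ, ht]
  sub_eq t₁ h₁ t₂ h₂ := by rw [hu h₁, hu h₂, h.sub_eq t₁ h₁ t₂ h₂]

theorem add_of_ordConnected [Fact (1 < p)] [J.OrdConnected] (h : IsYFun ι p J u w v)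
    (h' : IsYFun ι p J u' w' v') : IsYFun ι p J (u + u') (w + w') (v + v') where
  memLp_fun := h.memLp_fun.add h'.memLp_fun
  memLp_deriv := h.memLp_deriv.add h'.memLp_deriv
  ae_eq := by
    filter_upwards [h.ae_eq, h'.ae_eq] with t ht ht'
    simp [ht, ht']
  sub_eq t₁ h₁ t₂ h₂ := by
    simp only [Pi.add_apply]
    rw [intervalIntegral.integral_add (intervalIntegrable_of_memLp h.memLp_deriv h₁ h₂)
      (intervalIntegrable_of_memLp h'.memLp_deriv h₁ h₂), ← h.sub_eq t₁ h₁ t₂ h₂,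
      ← h'.sub_eq t₁ h₁ t₂ h₂]
    abel

theorem neg (h : IsYFun ι p J u w v) : IsYFun ι p J (-u) (-w) (-v) := by
  simpa using h.smul (-1)

theorem sub [Fact (1 < p)] [J.OrdConnected] (h : IsYFun ι p J u w v)
    (h' : IsYFun ι p J u' w' v') : IsYFun ι p J (u - u') (w - w') (v - v') := by
  simpa only [sub_eq_add_neg] using h.add_of_ordConnected h'.neg

theorem comp_add_right (h : IsYFun ι p J u w v) (hJ : MeasurableSet J) (c : ℝ)
    (hJ' : ∀ x, x ∈ J' ↔ x + c ∈ J) :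
    IsYFun ι p J' (fun t => u (t + c)) (fun t => w (t + c)) (fun t => v (t + c)) := by
  have hφ := measurePreserving_restrict (measurePreserving_add_right volume c) hJ hJ'
  exact
  { memLp_fun := h.memLp_fun.comp_measurePreserving hφ
    memLp_deriv := h.memLp_deriv.comp_measurePreserving hφ
    ae_eq := hφ.quasiMeasurePreserving.ae h.ae_eq
    sub_eq := fun t₁ h₁ t₂ h₂ => by
      rw [h.sub_eq _ ((hJ' _).1 h₁) _ ((hJ' _).1 h₂), intervalIntegral.integral_comp_add_right] }

theorem comp_sub_left (h : IsYFun ι p J u w v) (hJ : MeasurableSet J) (c : ℝ)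
    (hJ' : ∀ x, x ∈ J' ↔ c - x ∈ J) :
    IsYFun ι p J' (fun t => u (c - t)) (fun t => w (c - t)) (-fun t => v (c - t)) := by
  have hφ := measurePreserving_restrict (Measure.measurePreserving_sub_left volume c) hJ hJ'
  exact
  { memLp_fun := h.memLp_fun.comp_measurePreserving hφ
    memLp_deriv := (h.memLp_deriv.comp_measurePreserving hφ).neg
    ae_eq := hφ.quasiMeasurePreserving.ae h.ae_eq
    sub_eq := fun t₁ h₁ t₂ h₂ => by
      rw [h.sub_eq _ ((hJ' _).1 h₁) _ ((hJ' _).1 h₂)]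
      simp only [Pi.neg_apply, intervalIntegral.integral_neg,
        intervalIntegral.integral_comp_sub_left (fun t => v t)]
      rw [intervalIntegral.integral_symm] }

/-- A function that vanishes at the left end point can be extended by `0` to the left. -/
theorem indicator_Icc [Fact (1 < p)] {a b : ℝ} (h : IsYFun ι p (Icc a b) u w v) (ha : u a = 0) :
    IsYFun ι p (Iic b) ((Icc a b).indicator u) ((Icc a b).indicator w)
      ((Icc a b).indicator v) := by
  have hsub : Icc a b ⊆ Iic b := fun x hx => hx.2
  have hv : MemLp ((Icc a b).indicator v) (ENNReal.ofReal p) volume :=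
    (memLp_indicator_iff_restrict measurableSet_Icc).2 h.memLp_deriv
  have hint : ∀ s t : ℝ, IntervalIntegrable ((Icc a b).indicator v) volume s t := fun s t =>
    intervalIntegrable_of_memLp (p := p) (J := univ) (by simpa using hv) (mem_univ _) (mem_univ _)
  have key : ∀ t ∈ Iic b, (Icc a b).indicator u t = ∫ s in a..t, (Icc a b).indicator v s := by
    intro t ht
    rcases lt_or_ge t a with hta | hat
    · rw [indicator_of_notMem (fun hm => hta.not_ge hm.1), eq_comm,
        intervalIntegral.integral_symm, neg_eq_zero]
      apply intervalIntegral.integral_zero_ae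
      -- The indicator of `v` may be nonzero at `a` itself, a null set.
      have : ∀ᵐ x : ℝ, x ≠ a := by simp [ae_iff]
      filter_upwards [this] with x hx hxm
      rw [uIoc_of_le hta.le] at hxm
      exact indicator_of_notMem (fun hm => hx (le_antisymm hxm.2 hm.1)) _
    · rw [indicator_of_mem (show t ∈ Icc a b from ⟨hat, ht⟩)]
      have := h.sub_eq a ⟨le_rfl, hat.trans ht⟩ t ⟨hat, ht⟩
      rw [ha, sub_zero] at this
      rw [this]
      refine intervalIntegral.integral_congr fun x hx => ?_
      rw [uIcc_of_le hat] at hx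
      exact (indicator_of_mem (show x ∈ Icc a b from ⟨hx.1, hx.2.trans ht⟩) _).symm
  exact
  { memLp_fun := memLp_indicator measurableSet_Icc hsub h.memLp_fun
    memLp_deriv := memLp_indicator measurableSet_Icc hsub h.memLp_deriv
    ae_eq := by
      have h1 := (ae_restrict_iff' measurableSet_Icc).1 h.ae_eq
      filter_upwards [ae_restrict_of_ae h1] with t ht
      by_cases hm : t ∈ Icc a b
      · simp [hm, ht hm]
      · simp [hm]
    sub_eq := fun t₁ h₁ t₂ h₂ => by
      rw [key t₁ h₁, key t₂ h₂, intervalIntegral.integral_interval_sub_left (hint _ _)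
        (hint _ _)] }

end IsYFun

/-! ### Traces -/

namespace TraceSpace

variable {E₀ E₁ : Type*} [NormedAddCommGroup E₀] [NormedSpace ℂ E₀]
  [NormedAddCommGroup E₁] [NormedSpace ℂ E₁] {ι : E₁ →L[ℂ] E₀} {p : ℝ} [Fact (1 < p)]
  {u v : ℝ → E₀} {w : ℝ → E₁}

theorem incl_injective : Function.Injective (incl ι p) := Subtype.val_injective

theorem norm_le {x : TraceSpace ι p} (h : IsYFun ι p (Ici 0) u w v) (hu : u 0 = incl ι p x) :
    ‖x‖ ≤ pnorm p (Ici 0) w + pnorm p (Ici 0) v :=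
  csInf_le (traceNormSet_bddBelow _) ⟨u, w, v, h, hu, rfl⟩

theorem exists_incl_eq (h : IsYFun ι p (Ici 0) u w v) :
    ∃ x, incl ι p x = u 0 := ⟨⟨u 0, u, w, v, h, rfl⟩, rfl⟩

/-- The infimum in the trace norm need not be attained, hence the factor 2. It leaves no room when
`x = 0`, where the zero function serves. -/
theorem exists_extension (x : TraceSpace ι p) :
    ∃ u w v, IsYFun ι p (Ici 0) u w v ∧ u 0 = incl ι p x ∧
      pnorm p (Ici 0) w + pnorm p (Ici 0) v ≤ 2 * ‖x‖ := by
  rcases eq_or_ne x 0 with rfl | hx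
  · exact ⟨_, _, _, IsYFun.zero, by simp, by simp [pnorm_zero]⟩
  · obtain ⟨r, ⟨u, w, v, h, hu, rfl⟩, hr⟩ :=
      Real.lt_sInf_add_pos x.traceNormSet_nonempty (norm_pos_iff.2 hx)
    refine ⟨u, w, v, h, hu, ?_⟩
    rw [← norm_def] at hr
    rw [pnorm, pnorm]
    linarith

/-- Values of functions on the half line belong to the trace space. -/
theorem exists_incl_eq_of_Ici (h : IsYFun ι p (Ici 0) u w v) {t : ℝ} (ht : 0 ≤ t) :
    ∃ x, incl ι p x = u t ∧ ‖x‖ ≤ pnorm p (Ici 0) w + pnorm p (Ici 0) v := by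
  have hsub : Ici t ⊆ Ici (0 : ℝ) := Ici_subset_Ici.2 ht
  have hJ : ∀ x : ℝ, x ∈ Ici (0 : ℝ) ↔ x + t ∈ Ici t := fun x => by simp
  have h1 := (h.mono hsub).comp_add_right measurableSet_Ici t hJ
  obtain ⟨x, hx⟩ := exists_incl_eq h1
  refine ⟨x, by simpa using hx, (norm_le h1 hx.symm).trans (add_le_add ?_ ?_)⟩
  · exact (pnorm_comp (measurePreserving_add_right volume t) measurableSet_Ici hJ
      (h.mono hsub).memLp_fun).trans_le (pnorm_mono_set hsub h.memLp_fun)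
  · exact (pnorm_comp (measurePreserving_add_right volume t) measurableSet_Ici hJ
      (h.mono hsub).memLp_deriv).trans_le (pnorm_mono_set hsub h.memLp_deriv)

/-- Values of functions which vanish at the left end point belong to the trace space. -/
theorem exists_incl_eq_of_left_eq_zero {a b : ℝ} (h : IsYFun ι p (Icc a b) u w v) (ha : u a = 0)
    (hab : a ≤ b) : ∃ x, incl ι p x = u b ∧ ‖x‖ ≤ pnorm p (Icc a b) w + pnorm p (Icc a b) v := by
  have hsub : Icc a b ⊆ Iic b := fun x hx => hx.2
  have hJ : ∀ x : ℝ, x ∈ Ici (0 : ℝ) ↔ b - x ∈ Iic b := fun x => by simp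
  have h0 := h.indicator_Icc ha
  -- The reflection `t ↦ b - t` turns the zero extension on `Iic b` into a function on the half line
  -- whose initial value is `u b`, without changing norms.
  have h1 := h0.comp_sub_left measurableSet_Iic b hJ
  obtain ⟨x, hx⟩ := exists_incl_eq h1
  refine ⟨x, by simpa [hab] using hx, (norm_le h1 hx.symm).trans (add_le_add ?_ ?_)⟩
  · exact ((pnorm_comp (Measure.measurePreserving_sub_left volume b) measurableSet_Iic hJ
      h0.memLp_fun).trans (pnorm_indicator measurableSet_Icc hsub)).le
  · rw [pnorm_neg]
    exact ((pnorm_comp (Measure.measurePreserving_sub_left volume b) measurableSet_Iic hJ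
      h0.memLp_deriv).trans (pnorm_indicator measurableSet_Icc hsub)).le

/-- The trace estimate on a bounded interval, with a constant independent of the interval. -/
theorem norm_apply_le {a b : ℝ} {u : ℝ → TraceSpace ι p}
    (h : IsYFun ι p (Icc a b) (fun t => incl ι p (u t)) w v) {t : ℝ} (ht : t ∈ Icc a b) :
    ‖u t‖ ≤ 4 * ‖u a‖ + (pnorm p (Icc a b) w + pnorm p (Icc a b) v) := by
  obtain ⟨y, wy, vy, hy, hy0, hyn⟩ := exists_extension (u a)
  have hsub : Icc a t ⊆ Icc a b := Icc_subset_Icc_right ht.2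
  have hsub' : Icc a b ⊆ Ici a := fun x hx => hx.1
  have hJ : ∀ x : ℝ, x ∈ Ici a ↔ x + -a ∈ Ici (0 : ℝ) := fun x => by simp
  have hya := hy.comp_add_right measurableSet_Ici (-a) hJ
  have hyw := pnorm_comp (measurePreserving_add_right volume (-a)) measurableSet_Ici hJ
    hy.memLp_fun
  have hyv := pnorm_comp (measurePreserving_add_right volume (-a)) measurableSet_Ici hJ
    hy.memLp_deriv
  have hd := (h.mono hsub).sub (hya.mono (hsub.trans hsub'))
  obtain ⟨x, hx, hxn⟩ := exists_incl_eq_of_left_eq_zero hd (by simp [hy0]) ht.1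
  obtain ⟨x', hx', hxn'⟩ := exists_incl_eq_of_Ici hy (t := t + -a) (by linarith [ht.1])
  have hut : u t = x + x' := incl_injective (by
    rw [map_add, hx, hx', Pi.sub_apply]
    abel)
  have e1 := pnorm_sub_le (h.mono hsub).memLp_fun (hya.mono (hsub.trans hsub')).memLp_fun
  have e2 := pnorm_sub_le (h.mono hsub).memLp_deriv (hya.mono (hsub.trans hsub')).memLp_deriv
  have e3 := pnorm_mono_set hsub h.memLp_fun
  have e4 := pnorm_mono_set hsub h.memLp_deriv
  have e5 := pnorm_mono_set (hsub.trans hsub') hya.memLp_fun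
  have e6 := pnorm_mono_set (hsub.trans hsub') hya.memLp_deriv
  rw [Function.comp_def] at hyw hyv
  have e7 := norm_add_le x x'
  rw [hut]
  linarith

end TraceSpace

/-! ### Continuity properties of `L^p` norms -/

section ContinuityLp

variable {F : Type*} [NormedAddCommGroup F] {p : ℝ} [hp : Fact (1 < p)] {f : ℝ → F}

/-- Absolute continuity of the integral: `δ` bounds the length of the subinterval, whatever its
position. -/
theorem exists_pnorm_Icc_le {a b : ℝ}
    (hf : MemLp f (ENNReal.ofReal p) (volume.restrict (Icc a b))) {ε : ℝ} (hε : 0 < ε) :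
    ∃ δ > 0, ∀ c d, Icc c d ⊆ Icc a b → d - c ≤ δ → pnorm p (Icc c d) f ≤ ε := by
  obtain ⟨δ, hδ, h⟩ := hf.eLpNorm_indicator_le one_le_ofReal_of_fact ENNReal.ofReal_ne_top hε
  refine ⟨δ, hδ, fun c d hsub hcd => ?_⟩
  have h1 := h (Icc c d) measurableSet_Icc (by
    rw [Measure.restrict_apply measurableSet_Icc, inter_eq_self_of_subset_left hsub,
      Real.volume_Icc]
    exact ENNReal.ofReal_le_ofReal hcd)
  rw [← pnorm_indicator measurableSet_Icc hsub]
  exact ENNReal.toReal_le_of_le_ofReal hε.le h1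

theorem continuousOn_pnorm_Icc {a b : ℝ}
    (hf : MemLp f (ENNReal.ofReal p) (volume.restrict (Icc a b))) :
    ContinuousOn (fun t => pnorm p (Icc a t) f) (Icc a b) := by
  have hp0 : 0 < p := zero_lt_one.trans hp.out
  have hP0 : ENNReal.ofReal p ≠ 0 := by simpa using hp0
  have hint : IntegrableOn (fun t => ‖f t‖ ^ p) (Icc a b) := by
    have := hf.integrable_norm_rpow hP0 ENNReal.ofReal_ne_top
    rwa [ENNReal.toReal_ofReal hp0.le] at this
  have h1 := intervalIntegral.continuousOn_primitive_Icc hint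
  refine (h1.rpow_const (p := p⁻¹) fun t _ => Or.inr (by positivity)).congr fun t ht => ?_
  have hft := hf.restrict_mono_set (Icc_subset_Icc_right ht.2)
  rw [pnorm, hft.eLpNorm_eq_integral_rpow_norm hP0 ENNReal.ofReal_ne_top,
    ENNReal.toReal_ofReal (by positivity), ENNReal.toReal_ofReal hp0.le]

theorem tendsto_pnorm_Icc {a b : ℝ} (hab : a ≤ b)
    (hf : MemLp f (ENNReal.ofReal p) (volume.restrict (Icc a b))) :
    Tendsto (fun t => pnorm p (Icc a t) f) (𝓝[Icc a b] a) (𝓝 0) := by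
  have := continuousOn_pnorm_Icc hf a (left_mem_Icc.2 hab)
  have h0 : pnorm p (Icc a a) f = 0 := by simp [pnorm]
  rwa [ContinuousWithinAt, h0] at this

/-- Continuity of translations in `L^p` of the half line. -/
theorem tendsto_pnorm_translate_sub
    (hf : MemLp f (ENNReal.ofReal p) (volume.restrict (Ici 0))) :
    Tendsto (fun h => pnorm p (Ici 0) ((fun t => f (t + h)) - f)) (𝓝[Ici 0] 0) (𝓝 0) := by
  have : Fact (1 ≤ ENNReal.ofReal p) := ⟨one_le_ofReal_of_fact⟩
  -- For `h ≥ 0` the translates of `f` and of its zero extension agree on the half line, so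
  -- continuity of translations in `L^p(ℝ)` applies.
  set g := (Ici (0 : ℝ)).indicator f with hg
  have hgm : MemLp g (ENNReal.ofReal p) volume :=
    (memLp_indicator_iff_restrict measurableSet_Ici).2 hf
  let τ : C(ℝ, C(ℝ, ℝ)) := (ContinuousMap.mk (fun a : ℝ × ℝ => a.2 + a.1)).curry
  have hτ : ∀ h, MeasurePreserving (τ h) (volume : Measure ℝ) volume := fun h =>
    measurePreserving_add_right volume h
  have hcont : Continuous fun h : ℝ =>
      Lp.compMeasurePreserving (τ h) (hτ h) (hgm.toLp g) :=
    continuous_const.compMeasurePreservingLp τ.continuous hτ ENNReal.ofReal_ne_top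
  have hz : Lp.compMeasurePreserving (τ 0) (hτ 0) (hgm.toLp g) = hgm.toLp g := by
    rw [Lp.toLp_compMeasurePreserving]
    congr 1
    ext t
    simp [τ]
  have ht : Tendsto (fun h : ℝ => ‖Lp.compMeasurePreserving (τ h) (hτ h) (hgm.toLp g)
      - hgm.toLp g‖) (𝓝[Ici 0] 0) (𝓝 0) := by
    have h1 := ((hcont.sub continuous_const).norm (E := Lp F (ENNReal.ofReal p) volume)).tendsto
      (x := (0 : ℝ)) (f := fun h : ℝ => ‖Lp.compMeasurePreserving (τ h) (hτ h) (hgm.toLp g)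
      - hgm.toLp g‖)
    simp only [hz, sub_self, norm_zero] at h1
    exact h1.mono_left nhdsWithin_le_nhds
  refine squeeze_zero' (Eventually.of_forall fun _ => pnorm_nonneg) ?_ ht
  filter_upwards [self_mem_nhdsWithin] with h hh
  have hgh : MemLp (g ∘ τ h) (ENNReal.ofReal p) volume := hgm.comp_measurePreserving (hτ h)
  rw [Lp.toLp_compMeasurePreserving, ← MemLp.toLp_sub, Lp.norm_toLp]
  have e1 : pnorm p (Ici 0) ((fun t => f (t + h)) - f) = pnorm p (Ici 0) (g ∘ τ h - g) := by
    refine pnorm_congr_ae ?_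
    filter_upwards [ae_restrict_mem measurableSet_Ici] with t ht
    have : (0 : ℝ) ≤ t + h := add_nonneg ht hh
    simp [g, τ, this, mem_Ici.1 ht]
  rw [e1]
  exact ENNReal.toReal_mono (hgh.sub hgm).eLpNorm_ne_top
    (eLpNorm_mono_measure _ Measure.restrict_le_self)

end ContinuityLp

/-! ### Continuity with values in the trace space -/

namespace TraceSpace

variable {E₀ E₁ : Type*} [NormedAddCommGroup E₀] [NormedSpace ℂ E₀]
  [NormedAddCommGroup E₁] [NormedSpace ℂ E₁] {ι : E₁ →L[ℂ] E₀} {p : ℝ} [Fact (1 < p)]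
  {u : ℝ → TraceSpace ι p} {v : ℝ → E₀} {w : ℝ → E₁}

/-- Let `y` extend `u a` to the half line, with its time origin moved to `a`. Then `u - y` vanishes
at `a`, so its value at `t` is bounded by its norm on `[a, t]`, which tends to 0. The increment of
`y` over a time `h = t - a` is the trace of `y(· + h) - y`, which is small by continuity of
translations. -/
theorem continuousWithinAt_left {a b : ℝ} (hab : a ≤ b)
    (h : IsYFun ι p (Icc a b) (fun t => incl ι p (u t)) w v) :
    ContinuousWithinAt u (Icc a b) a := by
  obtain ⟨y, wy, vy, hy, hy0, -⟩ := exists_extension (u a)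
  have hsub' : Icc a b ⊆ Ici a := fun x hx => hx.1
  have hJ : ∀ x : ℝ, x ∈ Ici a ↔ x + -a ∈ Ici (0 : ℝ) := fun x => by simp
  have hya := (hy.comp_add_right measurableSet_Ici (-a) hJ).mono hsub'
  have hd := h.sub hya
  have hshift : Tendsto (fun t => t - a) (𝓝[Icc a b] a) (𝓝[Ici 0] 0) := by
    refine tendsto_nhdsWithin_iff.2 ⟨?_, ?_⟩
    · have : Continuous fun t : ℝ => t - a := by fun_prop
      simpa using (this.tendsto a).mono_left nhdsWithin_le_nhds
    · filter_upwards [self_mem_nhdsWithin] with t ht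
      exact sub_nonneg.2 ht.1
  have hlim := ((tendsto_pnorm_Icc hab hd.memLp_fun).add
    (tendsto_pnorm_Icc hab hd.memLp_deriv)).add
    (((tendsto_pnorm_translate_sub hy.memLp_fun).comp hshift).add
    ((tendsto_pnorm_translate_sub hy.memLp_deriv).comp hshift))
  simp only [add_zero] at hlim
  rw [ContinuousWithinAt, tendsto_iff_norm_sub_tendsto_zero]
  refine squeeze_zero' (Eventually.of_forall fun _ => norm_nonneg _) ?_ hlim
  filter_upwards [self_mem_nhdsWithin] with t ht
  obtain ⟨x, hx, hxn⟩ := exists_incl_eq_of_left_eq_zero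
    (hd.mono (Icc_subset_Icc_right ht.2)) (by simp [hy0]) ht.1
  have hta : 0 ≤ t - a := sub_nonneg.2 ht.1
  have hsub : Ici (t - a) ⊆ Ici (0 : ℝ) := Ici_subset_Ici.2 hta
  have hyt := ((hy.mono hsub).comp_add_right (J' := Ici 0) measurableSet_Ici (t - a)
    fun x => by simp).sub hy
  obtain ⟨x', hx'⟩ := exists_incl_eq hyt
  have hxn' := norm_le hyt hx'.symm
  have hut : u t - u a = x + x' := incl_injective (by
    rw [map_add, map_sub, hx, hx', ← hy0]
    simp [sub_eq_add_neg])
  rw [hut]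
  exact (norm_add_le _ _).trans (add_le_add hxn hxn')

/-- Every point is the left end point of a remaining interval, and time reversal reduces continuity
from the left to continuity from the right. -/
theorem continuousOn {a b : ℝ} (h : IsYFun ι p (Icc a b) (fun t => incl ι p (u t)) w v) :
    ContinuousOn u (Icc a b) := by
  intro t ht
  have hr := continuousWithinAt_left ht.2 (h.mono (Icc_subset_Icc_left ht.1))
  have hl : ContinuousWithinAt u (Icc a t) t := by
    have h1 := (h.mono (Icc_subset_Icc_right ht.2)).comp_sub_left (J' := Icc 0 (t - a))
      measurableSet_Icc t fun x => by simp only [mem_Icc]; constructor <;> rintro ⟨_, _⟩ <;>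
        constructor <;> linarith
    have h2 := continuousWithinAt_left (u := fun s => u (t - s)) (sub_nonneg.2 ht.1) h1
    have h3 : ContinuousWithinAt (fun s : ℝ => t - s) (Icc a t) t :=
      (by fun_prop : Continuous fun s : ℝ => t - s).continuousWithinAt
    have h4 := ContinuousWithinAt.comp_of_eq h2 h3 (fun s hs => by
      simp only [mem_Icc] at hs ⊢; constructor <;> linarith) (sub_self t)
    simpa [Function.comp_def] using h4
  rw [← Icc_union_Icc_eq_Icc ht.1 ht.2]
  exact hl.union hr

end TraceSpace

/-! ### The maximal regularity estimate -/

section Primitive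

variable {E : Type*} [NormedAddCommGroup E] [NormedSpace ℂ E] {p : ℝ} [hp : Fact (1 < p)]
  {T : ℝ}

instance : Fact (1 ≤ ENNReal.ofReal p) := ⟨one_le_ofReal_of_fact⟩

theorem setIntegral_Iic_eq_intervalIntegral {v : ℝ → E} {t : ℝ} (ht : t ∈ Icc 0 T) :
    ∫ s in Iic t, v s ∂(volume.restrict (Icc 0 T)) = ∫ s in (0 : ℝ)..t, v s := by
  rw [Measure.restrict_restrict measurableSet_Iic, intervalIntegral.integral_of_le ht.1,
    ← integral_Icc_eq_integral_Ioc]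
  congr 2
  ext x
  simp only [mem_inter_iff, mem_Iic, mem_Icc]
  exact ⟨fun h => ⟨h.2.1, h.1⟩, fun h => ⟨h.2, h.1, h.2.trans ht.2⟩⟩

omit hp in
theorem memLp_primitive {v : ℝ → E} (hv : Integrable v (volume.restrict (Icc 0 T))) :
    MemLp (fun t => ∫ s in Iic t, v s ∂(volume.restrict (Icc 0 T))) (ENNReal.ofReal p)
      (volume.restrict (Icc 0 T)) := by
  refine MemLp.of_bound ?_ (∫ s, ‖v s‖ ∂(volume.restrict (Icc 0 T)))
    (Eventually.of_forall fun t => ?_)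
  · have h : ContinuousOn (fun t => ∫ s in Icc 0 t, v s) (Icc 0 T) :=
      intervalIntegral.continuousOn_primitive_Icc hv
    refine (h.aestronglyMeasurable measurableSet_Icc).congr ?_
    filter_upwards [ae_restrict_mem measurableSet_Icc] with t ht
    rw [setIntegral_Iic_eq_intervalIntegral ht, intervalIntegral.integral_of_le ht.1,
      ← integral_Icc_eq_integral_Ioc]
  · exact (norm_integral_le_integral_norm _).trans
      (setIntegral_le_integral hv.norm (Eventually.of_forall fun _ => norm_nonneg _))

omit [NormedSpace ℂ E] in
theorem integrable_coeFn_Lp (v : Lp E (ENNReal.ofReal p) (volume.restrict (Icc 0 T))) :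
    Integrable v (volume.restrict (Icc 0 T)) :=
  (Lp.memLp v).integrable one_le_ofReal_of_fact

variable (E p T) in
/-- The integration operator `v ↦ (t ↦ ∫₀ᵗ v)` in `L^p((0, T) → E)`. -/
noncomputable def primitiveLp :
    Lp E (ENNReal.ofReal p) (volume.restrict (Icc 0 T)) →L[ℂ]
      Lp E (ENNReal.ofReal p) (volume.restrict (Icc 0 T)) :=
  LinearMap.mkContinuousOfExistsBound
    -- Integration over `Iic t` against the restricted measure makes sense for every real `t`, so
    -- the representatives are linear in `v` pointwise.
    { toFun := fun v => (memLp_primitive (integrable_coeFn_Lp v)).toLp _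
      map_add' := fun v v' => by
        rw [← MemLp.toLp_add]
        congr 1
        ext t
        rw [Pi.add_apply, ← integral_add (integrable_coeFn_Lp v).restrict
          (integrable_coeFn_Lp v').restrict]
        exact integral_congr_ae (ae_restrict_of_ae (Lp.coeFn_add v v'))
      map_smul' := fun c v => by
        rw [RingHom.id_apply, ← MemLp.toLp_const_smul]
        congr 1
        ext t
        rw [Pi.smul_apply, ← integral_smul]
        exact integral_congr_ae (ae_restrict_of_ae (Lp.coeFn_smul c v)) }
    (by
      refine ⟨((volume.restrict (Icc 0 T)) univ).toReal ^ (ENNReal.ofReal p).toReal⁻¹ *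
        ((volume.restrict (Icc 0 T)) univ ^
          (1 / (1 : ENNReal).toReal - 1 / (ENNReal.ofReal p).toReal)).toReal, fun v => ?_⟩
      have h1 : ∫ s, ‖v s‖ ∂(volume.restrict (Icc 0 T)) ≤ ‖v‖ *
          ((volume.restrict (Icc 0 T)) univ ^
          (1 / (1 : ENNReal).toReal - 1 / (ENNReal.ofReal p).toReal)).toReal := by
        rw [integral_norm_eq_lintegral_enorm (Lp.memLp v).1, ← eLpNorm_one_eq_lintegral_enorm,
          Lp.norm_def, ← ENNReal.toReal_mul]
        refine ENNReal.toReal_mono (ENNReal.mul_ne_top (Lp.memLp v).eLpNorm_ne_top ?_)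
          (eLpNorm_le_eLpNorm_mul_rpow_measure_univ one_le_ofReal_of_fact (Lp.memLp v).1)
        refine ENNReal.rpow_ne_top_of_nonneg ?_ (by simp)
        rw [ENNReal.toReal_ofReal (zero_le_one.trans hp.out.le)]
        simpa using inv_le_one_of_one_le₀ hp.out.le
      have h2 : ‖(memLp_primitive (p := p) (integrable_coeFn_Lp v)).toLp _‖ ≤
          ((volume.restrict (Icc 0 T)) univ).toReal ^ (ENNReal.ofReal p).toReal⁻¹ *
            ∫ s, ‖v s‖ ∂(volume.restrict (Icc 0 T)) := by
        refine Lp.norm_le_of_ae_bound (integral_nonneg fun _ => norm_nonneg _) ?_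
        filter_upwards [MemLp.coeFn_toLp (memLp_primitive (p := p) (integrable_coeFn_Lp v))]
          with t ht
        rw [ht]
        exact (norm_integral_le_integral_norm _).trans (setIntegral_le_integral
          (integrable_coeFn_Lp v).norm (Eventually.of_forall fun _ => norm_nonneg _))
      refine h2.trans ?_
      rw [mul_assoc, mul_comm _ ‖v‖]
      exact mul_le_mul_of_nonneg_left h1 (by positivity))

theorem primitiveLp_ae_eq (v : Lp E (ENNReal.ofReal p) (volume.restrict (Icc 0 T))) :
    primitiveLp E p T v =ᵐ[volume.restrict (Icc 0 T)] fun t => ∫ s in (0 : ℝ)..t, v s := by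
  filter_upwards [MemLp.coeFn_toLp (memLp_primitive (p := p) (integrable_coeFn_Lp v)),
    ae_restrict_mem measurableSet_Icc] with t ht htm
  rw [← setIntegral_Iic_eq_intervalIntegral htm, ← ht]
  rfl

end Primitive

/-! ### The open mapping argument for zero initial values -/

section Bound

variable {E₀ E₁ : Type*} [NormedAddCommGroup E₀] [NormedSpace ℂ E₀]
  [NormedAddCommGroup E₁] [NormedSpace ℂ E₁] {ι : E₁ →L[ℂ] E₀} {p : ℝ} [Fact (1 < p)]
  {T : ℝ} {B : E₁ →L[ℂ] E₀}

omit [Fact (1 < p)] in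
theorem MeasureTheory.MemLp.clm_apply {J : Set ℝ} {w : ℝ → E₁}
    (hw : MemLp w (ENNReal.ofReal p) (volume.restrict J)) (B : E₁ →L[ℂ] E₀) :
    MemLp (fun t => B (w t)) (ENNReal.ofReal p) (volume.restrict J) :=
  B.comp_memLp' hw

/-- Uniqueness in `MaximalRegularity` concerns functions with values in the trace space. Since `u`
vanishes at 0, its values lie there, and `u` can be compared with the zero solution. -/
theorem MaximalRegularity.eqOn_zero (hB : MaximalRegularity ι p T B)
    {u v : ℝ → E₀} {w : ℝ → E₁} (h : IsYFun ι p (Icc 0 T) u w v) (hu : u 0 = 0)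
    (hv : ∀ᵐ t ∂(volume.restrict (Icc 0 T)), v t = B (w t)) : EqOn u 0 (Icc 0 T) := by
  have hlift : ∀ t, ∃ x : TraceSpace ι p, t ∈ Icc 0 T → TraceSpace.incl ι p x = u t := by
    intro t
    by_cases ht : t ∈ Icc 0 T
    · obtain ⟨x, hx, -⟩ := TraceSpace.exists_incl_eq_of_left_eq_zero
        (h.mono (Icc_subset_Icc_right ht.2)) hu ht.1
      exact ⟨x, fun _ => hx⟩
    · exact ⟨0, fun h => absurd h ht⟩
  choose U hU using hlift
  intro t ht
  have hT : (0 : ℝ) ∈ Icc 0 T := ⟨le_rfl, ht.1.trans ht.2⟩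
  obtain ⟨-, _, -, hM⟩ := hB
  obtain ⟨u₁, -, huniq, -⟩ := hM 0 0 MemLp.zero
  have hs : IsStrictSolution ι p univ (fun _ _ => B) (fun _ _ => 0) 0 0 T 0 U := by
    refine ⟨TraceSpace.incl_injective (by rw [hU 0 hT, hu, map_zero]), fun _ _ => mem_univ _, w, v,
      h.congr measurableSet_Icc hU, h.memLp_fun.clm_apply B, MemLp.zero, MemLp.zero, ?_⟩
    filter_upwards [hv] with t ht
    simp [ht]
  have hs0 : IsStrictSolution ι p univ (fun _ _ => B) (fun _ _ => 0) 0 0 T 0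
      (fun _ => (0 : TraceSpace ι p)) := by
    refine ⟨rfl, fun _ _ => mem_univ _, fun _ => 0, fun _ => 0, by simpa using IsYFun.zero, ?_, ?_,
      ?_, ?_⟩ <;> simp
  rw [← hU t ht, huniq U hs ht, ← huniq _ hs0 ht, map_zero, Pi.zero_apply]

/-- By the open mapping theorem, maximal regularity implies an estimate in
`L^p((0, T) → E₁) ∩ W^{1,p}((0, T) → E₀)` for functions with initial value `0`. -/
theorem MaximalRegularity.exists_bound [CompleteSpace E₀] [CompleteSpace E₁]
    (hι : Function.Injective ι) (hT : 0 ≤ T)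
    (hB : MaximalRegularity ι p T B) : ∃ K : ℝ, 0 < K ∧ ∀ (u v : ℝ → E₀) (w : ℝ → E₁),
      IsYFun ι p (Icc 0 T) u w v → u 0 = 0 →
      pnorm p (Icc 0 T) w + pnorm p (Icc 0 T) v ≤ K * pnorm p (Icc 0 T) (fun t => v t - B (w t)) := by
  set μ := volume.restrict (Icc 0 T) with hμ
  set P := ENNReal.ofReal p with hP
  -- The kernel `Y` of `Φ` consists of the pairs `(w, v)` with `ι w = ∫₀ᵗ v`, that is, of functions
  -- with zero initial value together with their derivatives. It is closed, hence a Banach space,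
  -- and `D` sends such a function to `v - B w`.
  let Φ : Lp E₁ P μ × Lp E₀ P μ →L[ℂ] Lp E₀ P μ :=
    (ι.compLpL P μ).comp (.fst ℂ _ _) - (primitiveLp E₀ p T).comp (.snd ℂ _ _)
  let Y := LinearMap.ker (Φ : Lp E₁ P μ × Lp E₀ P μ →ₗ[ℂ] Lp E₀ P μ)
  have hYc : IsClosed (Y : Set (Lp E₁ P μ × Lp E₀ P μ)) := Φ.isClosed_ker
  have : CompleteSpace Y := hYc.completeSpace_coe
  let D : Y →L[ℂ] Lp E₀ P μ :=
    (ContinuousLinearMap.snd ℂ (Lp E₁ P μ) (Lp E₀ P μ)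
      - (B.compLpL P μ).comp (.fst ℂ _ _)).comp Y.subtypeL
  have hDapp : ∀ y : Y, D y =ᵐ[μ] fun t => y.1.2 t - B (y.1.1 t) := by
    intro y
    have e : D y = y.1.2 - B.compLp y.1.1 := rfl
    rw [e]
    filter_upwards [Lp.coeFn_sub y.1.2 (B.compLp y.1.1), B.coeFn_compLp y.1.1] with t h1 h2
    rw [h1, Pi.sub_apply, h2]
  have hmem : ∀ y : Lp E₁ P μ × Lp E₀ P μ,
      y ∈ Y ↔ ∀ᵐ t ∂μ, ι (y.1 t) = ∫ s in (0 : ℝ)..t, y.2 s := by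
    intro y
    have e : y ∈ Y ↔ ι.compLp y.1 = primitiveLp E₀ p T y.2 := by
      change ι.compLp y.1 - primitiveLp E₀ p T y.2 = 0 ↔ _
      rw [sub_eq_zero]
    rw [e, Lp.ext_iff]
    constructor <;> intro h <;>
    filter_upwards [h, ι.coeFn_compLp y.1, primitiveLp_ae_eq y.2] with t h1 h2 h3
    · rw [← h2, h1, h3]
    · rw [h2, h1, h3]
  have hlift : ∀ (u v : ℝ → E₀) (w : ℝ → E₁) (h : IsYFun ι p (Icc 0 T) u w v), u 0 = 0 →
      (h.memLp_fun.toLp w, h.memLp_deriv.toLp v) ∈ Y := by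
    intro u v w h hu
    rw [hmem]
    filter_upwards [h.memLp_fun.coeFn_toLp, h.ae_eq, ae_restrict_mem measurableSet_Icc]
      with t h1 h2 h3
    rw [h1, ← h2]
    have h4 := h.sub_eq 0 ⟨le_rfl, hT⟩ t h3
    rw [hu, sub_zero] at h4
    rw [h4]
    have h5 := (ae_restrict_iff' measurableSet_Icc).1 h.memLp_deriv.coeFn_toLp
    refine intervalIntegral.integral_congr_ae ?_
    filter_upwards [h5] with s hs hst
    rw [uIoc_of_le h3.1] at hst
    exact (hs ⟨hst.1.le, hst.2.trans h3.2⟩).symm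
  have hDlift : ∀ (u v : ℝ → E₀) (w : ℝ → E₁) (h : IsYFun ι p (Icc 0 T) u w v) (hu : u 0 = 0),
      D ⟨_, hlift u v w h hu⟩ =ᵐ[μ] fun t => v t - B (w t) := by
    intro u v w h hu
    filter_upwards [hDapp ⟨_, hlift u v w h hu⟩, h.memLp_fun.coeFn_toLp,
      h.memLp_deriv.coeFn_toLp] with t h1 h2 h3
    rw [h1, h2, h3]
  -- Surjectivity is solvability of the linear problem with initial value 0; injectivity is its
  -- uniqueness.
  have hsurj : Function.Surjective D := by
    intro g
    obtain ⟨-, _, -, hM⟩ := hB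
    obtain ⟨u, ⟨hu0, -, w, v, huY, -, -, -, heq⟩, -⟩ := hM 0 g (Lp.memLp g)
    refine ⟨⟨_, hlift _ v w huY (by rw [hu0, map_zero])⟩, Lp.ext ?_⟩
    filter_upwards [hDlift _ v w huY (by rw [hu0, map_zero]), heq] with t h1 h2
    rw [h1, h2, zero_add]
  have hinj : Function.Injective D := by
    rw [injective_iff_map_eq_zero]
    intro y hy
    have hY : IsYFun ι p (Icc 0 T) (fun t => ∫ s in (0 : ℝ)..t, y.1.2 s) y.1.1 y.1.2 :=
      { memLp_fun := Lp.memLp _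
        memLp_deriv := Lp.memLp _
        ae_eq := by
          filter_upwards [(hmem y.1).1 y.2] with t ht
          exact ht.symm
        sub_eq := fun t₁ h₁ t₂ h₂ => by
          have h0 : (0 : ℝ) ∈ Icc 0 T := ⟨le_rfl, hT⟩
          exact intervalIntegral.integral_interval_sub_left
            (intervalIntegrable_of_memLp (Lp.memLp y.1.2) h0 h₂)
            (intervalIntegrable_of_memLp (Lp.memLp y.1.2) h0 h₁) }
    have hv : ∀ᵐ t ∂μ, y.1.2 t = B (y.1.1 t) := by
      have h1 := hDapp y
      rw [hy] at h1
      filter_upwards [h1, Lp.coeFn_zero E₀ P μ] with t h1 h2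
      rw [h2] at h1
      exact sub_eq_zero.1 h1.symm
    have hz := hB.eqOn_zero hY (by simp) hv
    have hw : ∀ᵐ t ∂μ, y.1.1 t = 0 := by
      filter_upwards [hY.ae_eq, ae_restrict_mem measurableSet_Icc] with t h1 h2
      apply hι
      rw [← h1, map_zero]
      exact hz h2
    refine Subtype.ext (Prod.ext (Lp.ext ?_) (Lp.ext ?_))
    · filter_upwards [hw, Lp.coeFn_zero E₁ P μ] with t h1 h2
      rw [h1]
      exact h2.symm
    · filter_upwards [hw, hv, Lp.coeFn_zero E₀ P μ] with t h1 h2 h3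
      rw [h2, h1, map_zero]
      exact h3.symm
  obtain ⟨C, hC, hpre⟩ := D.exists_preimage_norm_le hsurj
  -- The norm of the product is a maximum, so the sum of the two components costs a factor 2.
  refine ⟨2 * C, by positivity, fun u v w h hu => ?_⟩
  obtain ⟨y, hy, hyn⟩ := hpre (D ⟨_, hlift u v w h hu⟩)
  rw [hinj hy] at hyn
  have e1 : ‖h.memLp_fun.toLp w‖ ≤ _ :=
    (norm_fst_le (h.memLp_fun.toLp w, h.memLp_deriv.toLp v)).trans hyn
  have e2 : ‖h.memLp_deriv.toLp v‖ ≤ _ :=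
    (norm_snd_le (h.memLp_fun.toLp w, h.memLp_deriv.toLp v)).trans hyn
  rw [Lp.norm_toLp, Lp.norm_def (D _), eLpNorm_congr_ae (hDlift u v w h hu)] at e1 e2
  change pnorm p (Icc 0 T) w ≤ C * pnorm p (Icc 0 T) (fun t => v t - B (w t)) at e1
  change pnorm p (Icc 0 T) v ≤ C * pnorm p (Icc 0 T) (fun t => v t - B (w t)) at e2
  linarith

end Bound

/-! ### Uniform maximal regularity estimates on short intervals -/

section UniformBound

variable {E₀ E₁ : Type*} [NormedAddCommGroup E₀] [NormedSpace ℂ E₀]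
  [NormedAddCommGroup E₁] [NormedSpace ℂ E₁] {ι : E₁ →L[ℂ] E₀} {p : ℝ} [Fact (1 < p)]
  {T K K' : ℝ} {B B' : E₁ →L[ℂ] E₀}

variable (ι p T) in
/-- The maximal regularity estimate with constant `K` on all intervals of length at most `T`. -/
def HasMaxRegBound (K : ℝ) (B : E₁ →L[ℂ] E₀) : Prop :=
  ∀ (a b : ℝ) (u : ℝ → TraceSpace ι p) (w : ℝ → E₁) (v : ℝ → E₀), a ≤ b → b - a ≤ T →
    IsYFun ι p (Icc a b) (fun t => TraceSpace.incl ι p (u t)) w v →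
    pnorm p (Icc a b) w + pnorm p (Icc a b) v ≤
      K * (pnorm p (Icc a b) (fun t => v t - B (w t)) + ‖u a‖)

theorem HasMaxRegBound.mono (h : HasMaxRegBound ι p T K B) (hK : K ≤ K') :
    HasMaxRegBound ι p T K' B := fun a b u w v hab hT hu =>
  (h a b u w v hab hT hu).trans (mul_le_mul_of_nonneg_right hK
    (add_nonneg pnorm_nonneg (norm_nonneg _)))

omit [Fact (1 < p)] in
theorem pnorm_clm_apply_le {J : Set ℝ} {w : ℝ → E₁}
    (hw : MemLp w (ENNReal.ofReal p) (volume.restrict J)) (B : E₁ →L[ℂ] E₀) :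
    pnorm p J (fun t => B (w t)) ≤ ‖B‖ * pnorm p J w := by
  rw [← pnorm_norm (f := w), ← pnorm_const_mul (norm_nonneg B)]
  refine pnorm_le_pnorm (hw.norm.const_mul _) (Eventually.of_forall fun t => ?_)
  rw [Real.norm_of_nonneg (by positivity)]
  exact B.le_opNorm _

/-- The term `(B' - B) w` contributes at most half of the norm of `w` and is absorbed on the left.
-/
theorem HasMaxRegBound.perturb (h : HasMaxRegBound ι p T K B) (hK : 0 ≤ K)
    (hB : K * ‖B' - B‖ ≤ 1 / 2) : HasMaxRegBound ι p T (2 * K) B' := by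
  intro a b u w v hab hT hu
  have h1 := h a b u w v hab hT hu
  have e : (fun t => v t - B (w t)) = (fun t => v t - B' (w t)) + fun t => (B' - B) (w t) := by
    ext t; simp
  have h2 := pnorm_add_le (hu.memLp_deriv.sub (hu.memLp_fun.clm_apply B'))
    (hu.memLp_fun.clm_apply (B' - B))
  have h3 := pnorm_clm_apply_le hu.memLp_fun (B' - B)
  change pnorm p (Icc a b) ((fun t => v t - B' (w t)) + fun t => (B' - B) (w t)) ≤
    pnorm p (Icc a b) (fun t => v t - B' (w t)) + _ at h2
  rw [← e] at h2
  have h4 : K * pnorm p (Icc a b) (fun t => v t - B (w t)) ≤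
      K * pnorm p (Icc a b) (fun t => v t - B' (w t)) + 1 / 2 * pnorm p (Icc a b) w := by
    have h5 : K * (‖B' - B‖ * pnorm p (Icc a b) w) ≤ 1 / 2 * pnorm p (Icc a b) w := by
      rw [← mul_assoc]
      exact mul_le_mul_of_nonneg_right hB pnorm_nonneg
    have h6 := mul_le_mul_of_nonneg_left (h2.trans (add_le_add_right h3 _)) hK
    linarith
  have h7 : 0 ≤ pnorm p (Icc a b) v := pnorm_nonneg
  have h8 : 0 ≤ K * ‖u a‖ := by positivity
  linarith

theorem MaximalRegularity.exists_hasMaxRegBound [CompleteSpace E₀] [CompleteSpace E₁]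
    (hι : Function.Injective ι) (hT : 0 ≤ T) (hB : MaximalRegularity ι p T B) :
    ∃ K : ℝ, 0 < K ∧ HasMaxRegBound ι p T K B := by
  obtain ⟨K, hK, hbd⟩ := hB.exists_bound hι hT
  have key : ∀ (a b : ℝ) (u v : ℝ → E₀) (w : ℝ → E₁), b - a ≤ T → IsYFun ι p (Icc a b) u w v →
      u a = 0 → pnorm p (Icc a b) w + pnorm p (Icc a b) v ≤
        K * pnorm p (Icc a b) (fun t => v t - B (w t)) := by
    intro a b u v w hab h ha
    -- Extending by zero to the left gives an interval of length exactly `T` without changing any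
    -- norm, so the constant does not deteriorate as the interval shrinks.
    have hsub : Icc a b ⊆ Icc (b - T) b := Icc_subset_Icc_left (by linarith)
    have hJ : ∀ x : ℝ, x ∈ Icc (0 : ℝ) T ↔ x + (b - T) ∈ Icc (b - T) b := fun x => by
      simp only [mem_Icc]; constructor <;> rintro ⟨_, _⟩ <;> constructor <;> linarith
    have hind := (h.indicator_Icc ha).mono (J' := Icc (b - T) b) fun x hx => hx.2
    have hsh := hind.comp_add_right measurableSet_Icc (b - T) hJ
    have hmp := measurePreserving_add_right (volume : Measure ℝ) (b - T)
    have h0 : (Icc a b).indicator u (0 + (b - T)) = 0 := by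
      by_cases hm : 0 + (b - T) ∈ Icc a b
      · rw [indicator_of_mem hm]
        have : 0 + (b - T) = a := by linarith [hm.1]
        rw [this, ha]
      · exact indicator_of_notMem hm _
    have hb := hbd _ _ _ hsh h0
    have e1 := (pnorm_comp hmp measurableSet_Icc hJ hind.memLp_fun).trans
      (pnorm_indicator measurableSet_Icc hsub)
    have e2 := (pnorm_comp hmp measurableSet_Icc hJ hind.memLp_deriv).trans
      (pnorm_indicator measurableSet_Icc hsub)
    have e3 := (pnorm_comp hmp measurableSet_Icc hJ
      (hind.memLp_deriv.sub (hind.memLp_fun.clm_apply B)))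
    have e4 : ((Icc a b).indicator v - fun t => B ((Icc a b).indicator w t)) =
        (Icc a b).indicator (fun t => v t - B (w t)) := by
      ext t
      by_cases hm : t ∈ Icc a b <;> simp [hm]
    rw [e4, pnorm_indicator measurableSet_Icc hsub, ← e4] at e3
    rw [← e1, ← e2, ← e3]
    exact hb
  refine ⟨K * (1 + ‖B‖) * 2 + 2 + K, by positivity, fun a b u w v hab hT h => ?_⟩
  -- Subtracting a translated extension of `u a` reduces to zero initial value. Its norm is at most
  -- `2‖u a‖`; it changes the residual by at most `(1 + ‖B‖) * (2‖u a‖)` and is added back at the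
  -- end.
  obtain ⟨y, wy, vy, hy, hy0, hyn⟩ := TraceSpace.exists_extension (u a)
  have hsub' : Icc a b ⊆ Ici a := fun x hx => hx.1
  have hJ : ∀ x : ℝ, x ∈ Ici a ↔ x + -a ∈ Ici (0 : ℝ) := fun x => by simp
  have hya := hy.comp_add_right measurableSet_Ici (-a) hJ
  have hyw := pnorm_comp (measurePreserving_add_right volume (-a)) measurableSet_Ici hJ
    hy.memLp_fun
  have hyv := pnorm_comp (measurePreserving_add_right volume (-a)) measurableSet_Ici hJ
    hy.memLp_deriv
  rw [Function.comp_def] at hyw hyv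
  have e5 := pnorm_mono_set hsub' hya.memLp_fun
  have e6 := pnorm_mono_set hsub' hya.memLp_deriv
  have hyb := hya.mono hsub'
  have hd := h.sub hyb
  have hk := key a b _ _ _ hT hd (by simp [hy0])
  set wa : ℝ → E₁ := fun t => wy (t + -a)
  set va : ℝ → E₀ := fun t => vy (t + -a)
  have hdiff : pnorm p (Icc a b) (fun t => (v - va) t - B ((w - wa) t)) ≤
      pnorm p (Icc a b) (fun t => v t - B (w t)) +
        (pnorm p (Icc a b) va + ‖B‖ * pnorm p (Icc a b) wa) := by
    have e : (fun t => (v - va) t - B ((w - wa) t)) =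
        (fun t => v t - B (w t)) - (va - fun t => B (wa t)) := by
      ext t; simp only [Pi.sub_apply, map_sub]; abel
    rw [e]
    refine (pnorm_sub_le (h.memLp_deriv.sub (h.memLp_fun.clm_apply B))
      (hyb.memLp_deriv.sub (hyb.memLp_fun.clm_apply B))).trans (add_le_add_right ?_ _)
    exact (pnorm_sub_le hyb.memLp_deriv (hyb.memLp_fun.clm_apply B)).trans
      (add_le_add_right (pnorm_clm_apply_le hyb.memLp_fun B) _)
  have ew : pnorm p (Icc a b) w ≤ pnorm p (Icc a b) (w - wa) + pnorm p (Icc a b) wa := by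
    simpa using pnorm_add_le hd.memLp_fun hyb.memLp_fun
  have ev : pnorm p (Icc a b) v ≤ pnorm p (Icc a b) (v - va) + pnorm p (Icc a b) va := by
    simpa using pnorm_add_le hd.memLp_deriv hyb.memLp_deriv
  have hwa : 0 ≤ pnorm p (Icc a b) wa := pnorm_nonneg
  have hva : 0 ≤ pnorm p (Icc a b) va := pnorm_nonneg
  have hN : pnorm p (Icc a b) va + pnorm p (Icc a b) wa ≤ 2 * ‖u a‖ := by linarith
  have hN' : pnorm p (Icc a b) va + ‖B‖ * pnorm p (Icc a b) wa ≤ (1 + ‖B‖) * (2 * ‖u a‖) := by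
    have := mul_le_mul_of_nonneg_left hN (by positivity : 0 ≤ 1 + ‖B‖)
    nlinarith [norm_nonneg B, mul_nonneg (norm_nonneg B) hva]
  have hK1 := mul_le_mul_of_nonneg_left (hdiff.trans (add_le_add_right hN' _)) hK.le
  set N := pnorm p (Icc a b) (fun t => v t - B (w t))
  have hNn : 0 ≤ N := pnorm_nonneg
  have h9 : pnorm p (Icc a b) w + pnorm p (Icc a b) v ≤
      K * (N + (1 + ‖B‖) * (2 * ‖u a‖)) + 2 * ‖u a‖ := by linarith
  refine h9.trans ?_
  have h10 : 0 ≤ K * (1 + ‖B‖) * 2 * N := by positivity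
  have h11 : 0 ≤ K * ‖u a‖ := by positivity
  nlinarith

/-- By `HasMaxRegBound.perturb` a bound at one time holds, with twice the constant, at all nearby
times; finitely many such neighbourhoods cover `S`. -/
theorem exists_uniform_hasMaxRegBound [CompleteSpace E₀] [CompleteSpace E₁]
    (hι : Function.Injective ι) (hT : 0 ≤ T) {S : Set ℝ} (hS : IsCompact S)
    {B : ℝ → E₁ →L[ℂ] E₀} (hB : ContinuousOn B S)
    (hmr : ∀ t ∈ S, MaximalRegularity ι p T (B t)) :
    ∃ K : ℝ, 1 ≤ K ∧ ∀ t ∈ S, HasMaxRegBound ι p T K (B t) := by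
  refine hS.induction_on (p := fun s => ∃ K : ℝ, 1 ≤ K ∧ ∀ t ∈ s, HasMaxRegBound ι p T K (B t))
    ⟨1, le_rfl, by simp⟩ ?_ ?_ ?_
  · rintro s t hst ⟨K, hK, h⟩
    exact ⟨K, hK, fun x hx => h x (hst hx)⟩
  · rintro s t ⟨K, hK, h⟩ ⟨K', hK', h'⟩
    refine ⟨max K K', hK.trans (le_max_left _ _), ?_⟩
    rintro x (hx | hx)
    · exact (h x hx).mono (le_max_left _ _)
    · exact (h' x hx).mono (le_max_right _ _)
  · intro x hx
    obtain ⟨K, hK, h⟩ := (hmr x hx).exists_hasMaxRegBound hι hT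
    have hev : ∀ᶠ t in 𝓝[S] x, dist (B t) (B x) < 1 / (2 * K) :=
      Metric.tendsto_nhds.1 (hB x hx) _ (by positivity)
    refine ⟨_, hev, max 1 (2 * K), le_max_left _ _, fun t ht => ?_⟩
    refine (h.perturb hK.le ?_).mono (le_max_right _ _)
    rw [mem_ofPred_eq, dist_eq_norm] at ht
    calc K * ‖B t - B x‖ ≤ K * (1 / (2 * K)) := mul_le_mul_of_nonneg_left ht.le hK.le
      _ = 1 / 2 := by field_simp

/-- Solvability of the linear problem on intervals of length at most `T`. -/
theorem MaximalRegularity.exists_solution (hB : MaximalRegularity ι p T B) {a b : ℝ}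
    (hab : b - a ≤ T) (x : TraceSpace ι p) {h : ℝ → E₀}
    (hh : MemLp h (ENNReal.ofReal p) (volume.restrict (Icc a b))) :
    ∃ (u : ℝ → TraceSpace ι p) (w : ℝ → E₁) (v : ℝ → E₀),
      IsYFun ι p (Icc a b) (fun t => TraceSpace.incl ι p (u t)) w v ∧ u a = x ∧
      ∀ᵐ t ∂(volume.restrict (Icc a b)), v t - B (w t) = h t := by
  obtain ⟨-, _, -, hM⟩ := hB
  have hsub : Icc a b ⊆ Icc a (a + T) := Icc_subset_Icc_right (by linarith)
  have hJ : ∀ x : ℝ, x ∈ Icc (0 : ℝ) T ↔ x + a ∈ Icc a (a + T) := fun x => by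
    simp only [mem_Icc]; constructor <;> rintro ⟨_, _⟩ <;> constructor <;> linarith
  have hJ' : ∀ x : ℝ, x ∈ Icc a (a + T) ↔ x + -a ∈ Icc (0 : ℝ) T := fun x => by
    simp only [mem_Icc]; constructor <;> rintro ⟨_, _⟩ <;> constructor <;> linarith
  -- The right-hand side is extended by zero to `[a, a + T]` and shifted to `[0, T]`; the solution
  -- found there is shifted back and restricted.
  have hg := (memLp_indicator measurableSet_Icc hsub hh).comp_measurePreserving
    (measurePreserving_restrict (measurePreserving_add_right volume a) measurableSet_Icc hJ)
  obtain ⟨u, ⟨hu0, -, w, v, huY, -, -, -, heq⟩, -⟩ := hM x _ hg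
  refine ⟨fun t => u (t + -a), fun t => w (t + -a), fun t => v (t + -a),
    (huY.comp_add_right measurableSet_Icc (-a) hJ').mono hsub, by simpa using hu0, ?_⟩
  have hmp := measurePreserving_restrict (measurePreserving_add_right volume (-a))
    measurableSet_Icc hJ'
  have h1 := ae_mono (Measure.restrict_mono_set volume hsub) (hmp.quasiMeasurePreserving.ae heq)
  filter_upwards [h1, ae_restrict_mem measurableSet_Icc] with t ht htm
  rw [ht]
  simp [htm]

end UniformBound

/-! ### The quasilinear problem near a reference solution -/

section Quasilinear

variable {E₀ E₁ : Type*} [NormedAddCommGroup E₀] [NormedSpace ℂ E₀]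
  [NormedAddCommGroup E₁] [NormedSpace ℂ E₁] {ι : E₁ →L[ℂ] E₀} {p : ℝ} [Fact (1 < p)]

omit [Fact (1 < p)] in
theorem ContinuousOn.memLp_Icc {F : Type*} [NormedAddCommGroup F] {a b : ℝ} {h : ℝ → F}
    (hh : ContinuousOn h (Icc a b)) :
    MemLp h (ENNReal.ofReal p) (volume.restrict (Icc a b)) := by
  obtain ⟨C, hC⟩ := isCompact_Icc.exists_bound_of_continuousOn hh
  refine MemLp.of_bound (hh.aestronglyMeasurable measurableSet_Icc) C ?_
  filter_upwards [ae_restrict_mem measurableSet_Icc] with t ht using hC t ht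

omit [Fact (1 < p)] in
theorem ContinuousOn.memLp_clm_apply {a b : ℝ} {C : ℝ → E₁ →L[ℂ] E₀} {w : ℝ → E₁}
    (hC : ContinuousOn C (Icc a b))
    (hw : MemLp w (ENNReal.ofReal p) (volume.restrict (Icc a b))) :
    MemLp (fun t => C t (w t)) (ENNReal.ofReal p) (volume.restrict (Icc a b)) := by
  obtain ⟨M, hM⟩ := isCompact_Icc.exists_bound_of_continuousOn hC
  refine MemLp.of_le_mul (c := M) hw ?_ ?_
  · exact (ContinuousLinearMap.id ℂ (E₁ →L[ℂ] E₀)).aestronglyMeasurable_comp₂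
      (hC.aestronglyMeasurable measurableSet_Icc) hw.1
  · filter_upwards [ae_restrict_mem measurableSet_Icc] with t ht
    exact (C t).le_of_opNorm_le (hM t ht) _

theorem pnorm_le_of_norm_le {F F₁ F₂ : Type*} [NormedAddCommGroup F] [NormedAddCommGroup F₁]
    [NormedAddCommGroup F₂] {J : Set ℝ} {h : ℝ → F} {h₁ : ℝ → F₁} {h₂ : ℝ → F₂} {e : ℝ → ℝ}
    {c d : ℝ} (hc : 0 ≤ c) (hd : 0 ≤ d)
    (m₁ : MemLp h₁ (ENNReal.ofReal p) (volume.restrict J))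
    (m₂ : MemLp h₂ (ENNReal.ofReal p) (volume.restrict J))
    (me : MemLp e (ENNReal.ofReal p) (volume.restrict J))
    (hle : ∀ᵐ t ∂(volume.restrict J), ‖h t‖ ≤ c * ‖h₁ t‖ + d * (‖h₂ t‖ + e t)) :
    pnorm p J h ≤ c * pnorm p J h₁ + d * (pnorm p J h₂ + pnorm p J e) := by
  have M₁ : MemLp (fun t => c * ‖h₁ t‖) (ENNReal.ofReal p) (volume.restrict J) :=
    m₁.norm.const_mul c
  have M₂ : MemLp ((fun t => ‖h₂ t‖) + e) (ENNReal.ofReal p) (volume.restrict J) := m₂.norm.add me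
  have M₃ : MemLp (fun t => d * ((fun t => ‖h₂ t‖) + e) t) (ENNReal.ofReal p)
    (volume.restrict J) := M₂.const_mul d
  have s1 : pnorm p J h ≤ pnorm p J ((fun t => c * ‖h₁ t‖) +
      fun t => d * ((fun t => ‖h₂ t‖) + e) t) := by
    refine pnorm_le_pnorm (M₁.add M₃) ?_
    filter_upwards [hle] with t ht
    exact ht.trans (le_abs_self _)
  refine s1.trans ((pnorm_add_le M₁ M₃).trans ?_)
  rw [pnorm_const_mul hc, pnorm_const_mul hd, pnorm_norm, ← pnorm_norm (f := h₂)]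
  exact add_le_add_right (mul_le_mul_of_nonneg_left (pnorm_add_le m₂.norm me) hd) _

/-- The inhomogeneity of the linear problem with the operator frozen at `(a, w(a))` that is
satisfied by the difference `d` of a strict solution and the reference solution `w`. Here `W` and
`ω` are `w` and `d` as `E₁`-valued functions. -/
def frozenRemainder (A : ℝ → TraceSpace ι p → E₁ →L[ℂ] E₀) (f : ℝ → TraceSpace ι p → E₀)
    (w : ℝ → TraceSpace ι p) (W : ℝ → E₁) (a : ℝ) (d : ℝ → TraceSpace ι p) (ω : ℝ → E₁)
    (t : ℝ) : E₀ :=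
  A t (w t + d t) (W t + ω t) - A t (w t) (W t) - A a (w a) (ω t)
    + (f t (w t + d t) - f t (w t))

/-- Uniform data for the local theory of the quasilinear problem along a reference solution `w`
whose `E₁`-valued version is `W`. -/
structure LocalFrame (ι : E₁ →L[ℂ] E₀) (p : ℝ) [Fact (1 < p)] (T : ℝ)
    (U : Set (TraceSpace ι p)) (A : ℝ → TraceSpace ι p → E₁ →L[ℂ] E₀)
    (f : ℝ → TraceSpace ι p → E₀) (w : ℝ → TraceSpace ι p) (W : ℝ → E₁)
    (L K r T₁ : ℝ) : Prop where
  L_nonneg : 0 ≤ L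
  one_le_K : 1 ≤ K
  r_pos : 0 < r
  T₁_pos : 0 < T₁
  T₁_le : T₁ ≤ T
  continuousOn_w : ContinuousOn w (Icc 0 T)
  memLp_W : MemLp W (ENNReal.ofReal p) (volume.restrict (Icc 0 T))
  A_lip : ∀ t ∈ Icc 0 T, ∀ t' ∈ Icc 0 T, ∀ x ∈ U, ∀ x' ∈ U,
    ‖A t x - A t' x'‖ ≤ L * (|t - t'| + ‖x - x'‖)
  f_lip : ∀ t ∈ Icc 0 T, ∀ t' ∈ Icc 0 T, ∀ x ∈ U, ∀ x' ∈ U,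
    ‖f t x - f t' x'‖ ≤ L * (|t - t'| + ‖x - x'‖)
  maxReg : ∀ t ∈ Icc 0 T, MaximalRegularity ι p T (A t (w t))
  bound : ∀ t ∈ Icc 0 T, HasMaxRegBound ι p T K (A t (w t))
  -- By the trace estimate, a difference of norm at most `r` with initial value at most `r` has sup
  -- norm at most `4r + r`.
  ball : ∀ t ∈ Icc 0 T, Metric.closedBall (w t) (5 * r) ⊆ U
  -- This bounds `A t (w t + x) - A a (w a)` for `‖x‖ ≤ 5 * r`, the error made by freezing the
  -- operator.
  osc : ∀ a t, 0 ≤ a → a ≤ t → t ≤ T → t ≤ a + T₁ →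
    L * (|t - a| + ‖w t - w a‖) + L * (5 * r) ≤ 1 / (4 * K)
  -- This controls what the Lipschitz dependence on the state contributes: `r` bounds `ω`, `‖W t‖`
  -- belongs to `A`, and the summand 1 belongs to `f`.
  small : ∀ a s, 0 ≤ a → a ≤ s → s ≤ T → s ≤ a + T₁ →
    L * (r + pnorm p (Icc a s) (fun t => ‖W t‖ + 1)) ≤ 1 / (4 * K)

namespace LocalFrame

variable {T : ℝ} {U : Set (TraceSpace ι p)} {A : ℝ → TraceSpace ι p → E₁ →L[ℂ] E₀}
  {f : ℝ → TraceSpace ι p → E₀} {w : ℝ → TraceSpace ι p} {W : ℝ → E₁} {L K r T₁ : ℝ}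

theorem mem_ball (F : LocalFrame ι p T U A f w W L K r T₁) {t : ℝ} (ht : t ∈ Icc 0 T)
    {x : TraceSpace ι p} (hx : ‖x‖ ≤ 5 * r) : w t + x ∈ U :=
  F.ball t ht (by simpa [Metric.mem_closedBall, dist_eq_norm] using hx)

theorem mem_U (F : LocalFrame ι p T U A f w W L K r T₁) {t : ℝ} (ht : t ∈ Icc 0 T) : w t ∈ U := by
  simpa using F.mem_ball ht (x := 0) (by simpa using F.r_pos.le)

theorem continuousOn_of_lip {F : Type*} [NormedAddCommGroup F]
    {φ : ℝ → TraceSpace ι p → F}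
    (hφ : ∀ t ∈ Icc 0 T, ∀ t' ∈ Icc 0 T, ∀ x ∈ U, ∀ x' ∈ U,
      ‖φ t x - φ t' x'‖ ≤ L * (|t - t'| + ‖x - x'‖))
    {a b : ℝ} (hab : Icc a b ⊆ Icc 0 T) {u : ℝ → TraceSpace ι p}
    (hu : ContinuousOn u (Icc a b)) (hU : ∀ t ∈ Icc a b, u t ∈ U) :
    ContinuousOn (fun t => φ t (u t)) (Icc a b) := by
  intro t ht
  have h1 : Tendsto (fun s => L * (|s - t| + ‖u s - u t‖)) (𝓝[Icc a b] t) (𝓝 0) := by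
    have h2 : ContinuousWithinAt (fun s => L * (|s - t| + ‖u s - u t‖)) (Icc a b) t :=
      continuousWithinAt_const.mul (((continuousWithinAt_id.sub continuousWithinAt_const).abs).add
        ((hu t ht).sub continuousWithinAt_const).norm)
    have h3 := h2.tendsto
    simpa using h3
  rw [ContinuousWithinAt, tendsto_iff_norm_sub_tendsto_zero]
  refine squeeze_zero' (Eventually.of_forall fun _ => norm_nonneg _) ?_ h1
  filter_upwards [self_mem_nhdsWithin] with s hs
  exact hφ s (hab hs) t (hab ht) _ (hU s hs) _ (hU t ht)

variable {a s : ℝ} {d d₁ d₂ : ℝ → TraceSpace ι p} {ω ω₁ ω₂ : ℝ → E₁} {ν ν₁ ν₂ : ℝ → E₀}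

theorem norm_le_five
    (h : IsYFun ι p (Icc a s) (fun t => TraceSpace.incl ι p (d t)) ω ν)
    (hr : pnorm p (Icc a s) ω + pnorm p (Icc a s) ν ≤ r) (h0 : ‖d a‖ ≤ r) {t : ℝ}
    (ht : t ∈ Icc a s) : ‖d t‖ ≤ 5 * r := by
  have := TraceSpace.norm_apply_le h ht
  linarith

theorem memLp_frozenRemainder (F : LocalFrame ι p T U A f w W L K r T₁) (ha : 0 ≤ a)
    (hsT : s ≤ T) (h : IsYFun ι p (Icc a s) (fun t => TraceSpace.incl ι p (d t)) ω ν)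
    (hr : pnorm p (Icc a s) ω + pnorm p (Icc a s) ν ≤ r) (h0 : ‖d a‖ ≤ r) :
    MemLp (frozenRemainder A f w W a d ω) (ENNReal.ofReal p) (volume.restrict (Icc a s)) := by
  have hsub : Icc a s ⊆ Icc 0 T := Icc_subset_Icc ha hsT
  have hw := F.continuousOn_w.mono hsub
  have hd := hw.add (TraceSpace.continuousOn h)
  have hdU : ∀ t ∈ Icc a s, w t + d t ∈ U := fun t ht =>
    F.mem_ball (hsub ht) (norm_le_five h hr h0 ht)
  have hwU : ∀ t ∈ Icc a s, w t ∈ U := fun t ht => F.mem_U (hsub ht)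
  have hW := F.memLp_W.restrict_mono_set hsub
  exact ((((continuousOn_of_lip F.A_lip hsub hd hdU).memLp_clm_apply
    (hW.add h.memLp_fun)).sub
    ((continuousOn_of_lip F.A_lip hsub hw hwU).memLp_clm_apply hW)).sub
    (h.memLp_fun.clm_apply _)).add
    ((continuousOn_of_lip F.f_lip hsub hd hdU).memLp_Icc.sub
      (continuousOn_of_lip F.f_lip hsub hw hwU).memLp_Icc)

/-- The contraction estimate. The difference of the remainders equals `(A(t, w+d₁) - A(a, w(a)))(ω₁
- ω₂)` plus `(A(t, w+d₁) - A(t, w+d₂))(ω₂ + W)` plus the difference of the `f` terms. The first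
coefficient is small by `osc`. In the others the sup norm of `d₁ - d₂`, controlled by the trace
estimate, multiplies an `L^p` norm that is small by `small`. The factor `1 / (2 * K)` leaves a
contraction by `1 / 2` after the linear problem is solved with constant `K`. -/
theorem pnorm_frozenRemainder_sub_le (F : LocalFrame ι p T U A f w W L K r T₁) (ha : 0 ≤ a)
    (has : a ≤ s) (hsT : s ≤ T) (hs : s ≤ a + T₁)
    (h₁ : IsYFun ι p (Icc a s) (fun t => TraceSpace.incl ι p (d₁ t)) ω₁ ν₁)
    (h₂ : IsYFun ι p (Icc a s) (fun t => TraceSpace.incl ι p (d₂ t)) ω₂ ν₂)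
    (hr₁ : pnorm p (Icc a s) ω₁ + pnorm p (Icc a s) ν₁ ≤ r) (h0₁ : ‖d₁ a‖ ≤ r)
    (hr₂ : pnorm p (Icc a s) ω₂ + pnorm p (Icc a s) ν₂ ≤ r) (h0₂ : ‖d₂ a‖ ≤ r) :
    pnorm p (Icc a s) (frozenRemainder A f w W a d₁ ω₁ - frozenRemainder A f w W a d₂ ω₂) ≤
      1 / (2 * K) * (pnorm p (Icc a s) (ω₁ - ω₂) + pnorm p (Icc a s) (ν₁ - ν₂) +
        2 * ‖d₁ a - d₂ a‖) := by
  have hK : 0 < K := zero_lt_one.trans_le F.one_le_K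
  have hL := F.L_nonneg
  have hsub : Icc a s ⊆ Icc 0 T := Icc_subset_Icc ha hsT
  have h12 : IsYFun ι p (Icc a s) (fun t => TraceSpace.incl ι p ((d₁ - d₂) t)) (ω₁ - ω₂)
      (ν₁ - ν₂) := by
    simpa [Pi.sub_def] using h₁.sub h₂
  have hW := F.memLp_W.restrict_mono_set hsub
  set N := pnorm p (Icc a s) (ω₁ - ω₂) + pnorm p (Icc a s) (ν₁ - ν₂) with hN
  -- `δ` is the bound that `TraceSpace.norm_apply_le` gives for `d₁ - d₂` on the whole interval.
  set δ := 4 * ‖d₁ a - d₂ a‖ + N with hδ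
  have hNω : pnorm p (Icc a s) (ω₁ - ω₂) ≤ N := le_add_of_nonneg_right pnorm_nonneg
  have hδ0 : 0 ≤ δ := by
    have : 0 ≤ N := add_nonneg pnorm_nonneg pnorm_nonneg
    positivity
  have hpt : ∀ᵐ t ∂(volume.restrict (Icc a s)),
      ‖(frozenRemainder A f w W a d₁ ω₁ - frozenRemainder A f w W a d₂ ω₂) t‖ ≤
        1 / (4 * K) * ‖(ω₁ - ω₂) t‖ + L * δ * (‖ω₂ t‖ + (‖W t‖ + 1)) := by
    filter_upwards [ae_restrict_mem measurableSet_Icc] with t ht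
    have htT := hsub ht
    have haT : a ∈ Icc 0 T := hsub ⟨le_rfl, has⟩
    have n1 := norm_le_five h₁ hr₁ h0₁ ht
    have n2 := norm_le_five h₂ hr₂ h0₂ ht
    have nd : ‖d₁ t - d₂ t‖ ≤ δ := TraceSpace.norm_apply_le h12 ht
    have U1 := F.mem_ball htT n1
    have U2 := F.mem_ball htT n2
    have hAB : ‖A t (w t + d₁ t) - A a (w a)‖ ≤ 1 / (4 * K) := by
      refine (F.A_lip t htT a haT _ U1 _ (F.mem_U haT)).trans
        (le_trans ?_ (F.osc a t ha ht.1 htT.2 (ht.2.trans hs)))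
      rw [← mul_add]
      refine mul_le_mul_of_nonneg_left ?_ hL
      have : w t + d₁ t - w a = (w t - w a) + d₁ t := by abel
      rw [this]
      linarith [norm_add_le (w t - w a) (d₁ t)]
    have hAA : ‖A t (w t + d₁ t) - A t (w t + d₂ t)‖ ≤ L * δ := by
      refine (F.A_lip t htT t htT _ U1 _ U2).trans (mul_le_mul_of_nonneg_left ?_ hL)
      simpa using nd
    have hff : ‖f t (w t + d₁ t) - f t (w t + d₂ t)‖ ≤ L * δ := by
      refine (F.f_lip t htT t htT _ U1 _ U2).trans (mul_le_mul_of_nonneg_left ?_ hL)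
      simpa using nd
    have e : (frozenRemainder A f w W a d₁ ω₁ - frozenRemainder A f w W a d₂ ω₂) t =
        (A t (w t + d₁ t) - A a (w a)) ((ω₁ - ω₂) t) +
        ((A t (w t + d₁ t) - A t (w t + d₂ t)) (ω₂ t + W t) +
          (f t (w t + d₁ t) - f t (w t + d₂ t))) := by
      simp only [frozenRemainder, Pi.sub_apply, sub_apply, map_add, map_sub]
      abel
    rw [e]
    have b1 := ContinuousLinearMap.le_of_opNorm_le _ hAB ((ω₁ - ω₂) t)
    have b2 := ContinuousLinearMap.le_of_opNorm_le _ hAA (ω₂ t + W t)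
    have b3 := mul_le_mul_of_nonneg_left (norm_add_le (ω₂ t) (W t)) (mul_nonneg hL hδ0)
    refine (norm_add_le _ _).trans (add_le_add b1 ((norm_add_le _ _).trans ?_))
    linarith
  have me : MemLp (fun t => ‖W t‖ + 1) (ENNReal.ofReal p) (volume.restrict (Icc a s)) :=
    hW.norm.add (memLp_const 1)
  have key := pnorm_le_of_norm_le (by positivity) (mul_nonneg hL hδ0) h12.memLp_fun h₂.memLp_fun
    me hpt
  have hω₂ : pnorm p (Icc a s) ω₂ ≤ r := le_trans (le_add_of_nonneg_right pnorm_nonneg) hr₂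
  have h3 : L * δ * (pnorm p (Icc a s) ω₂ + pnorm p (Icc a s) (fun t => ‖W t‖ + 1)) ≤
      1 / (4 * K) * δ := by
    rw [mul_right_comm]
    refine mul_le_mul_of_nonneg_right (le_trans ?_ (F.small a s ha has hsT hs)) hδ0
    exact mul_le_mul_of_nonneg_left (add_le_add_left hω₂ _) hL
  have h4 := mul_le_mul_of_nonneg_left hNω (by positivity : 0 ≤ 1 / (4 * K))
  have h5 : 1 / (2 * K) * (N + 2 * ‖d₁ a - d₂ a‖) = 1 / (4 * K) * N + 1 / (4 * K) * δ := by
    rw [hδ]; field_simp; ring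
  rw [h5]
  linarith

theorem frozenRemainder_zero (a : ℝ) :
    frozenRemainder A f w W a (fun _ => 0) (fun _ => 0) = 0 := by
  ext t
  simp [frozenRemainder]

/-- The difference of two solutions near the reference solution is controlled by the difference of
the initial values. -/
theorem diff_bound (F : LocalFrame ι p T U A f w W L K r T₁) (ha : 0 ≤ a)
    (has : a ≤ s) (hsT : s ≤ T) (hs : s ≤ a + T₁)
    (h₁ : IsYFun ι p (Icc a s) (fun t => TraceSpace.incl ι p (d₁ t)) ω₁ ν₁)
    (h₂ : IsYFun ι p (Icc a s) (fun t => TraceSpace.incl ι p (d₂ t)) ω₂ ν₂)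
    (hr₁ : pnorm p (Icc a s) ω₁ + pnorm p (Icc a s) ν₁ ≤ r) (h0₁ : ‖d₁ a‖ ≤ r)
    (hr₂ : pnorm p (Icc a s) ω₂ + pnorm p (Icc a s) ν₂ ≤ r) (h0₂ : ‖d₂ a‖ ≤ r)
    (he₁ : ∀ᵐ t ∂(volume.restrict (Icc a s)),
      ν₁ t - A a (w a) (ω₁ t) = frozenRemainder A f w W a d₁ ω₁ t)
    (he₂ : ∀ᵐ t ∂(volume.restrict (Icc a s)),
      ν₂ t - A a (w a) (ω₂ t) = frozenRemainder A f w W a d₂ ω₂ t) :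
    pnorm p (Icc a s) (ω₁ - ω₂) + pnorm p (Icc a s) (ν₁ - ν₂) ≤
      (2 + 2 * K) * ‖d₁ a - d₂ a‖ := by
  have hK : 0 < K := zero_lt_one.trans_le F.one_le_K
  have h12 : IsYFun ι p (Icc a s) (fun t => TraceSpace.incl ι p ((d₁ - d₂) t)) (ω₁ - ω₂)
      (ν₁ - ν₂) := by
    simpa [Pi.sub_def] using h₁.sub h₂
  have hb := F.bound a ⟨ha, has.trans hsT⟩ a s _ _ _ has (by linarith [F.T₁_le]) h12
  have hc : pnorm p (Icc a s) (fun t => (ν₁ - ν₂) t - A a (w a) ((ω₁ - ω₂) t)) =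
      pnorm p (Icc a s) (frozenRemainder A f w W a d₁ ω₁ - frozenRemainder A f w W a d₂ ω₂) := by
    refine pnorm_congr_ae ?_
    filter_upwards [he₁, he₂] with t e₁ e₂
    rw [Pi.sub_apply, Pi.sub_apply, Pi.sub_apply, ← e₁, ← e₂, map_sub]
    abel
  rw [hc, Pi.sub_apply] at hb
  have hd := mul_le_mul_of_nonneg_left
    (F.pnorm_frozenRemainder_sub_le ha has hsT hs h₁ h₂ hr₁ h0₁ hr₂ h0₂) hK.le
  rw [← mul_assoc] at hd
  -- With `N` the left-hand side and `δ₀` the distance of the initial values, `N ≤ N / 2 + δ₀ + K *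
  -- δ₀`; half of `N` is absorbed.
  have hk : K * (1 / (2 * K)) = 1 / 2 := by field_simp
  rw [hk] at hd
  linarith

/-- A priori bound: a solution that starts near the reference solution stays near it. -/
theorem a_priori_bound (F : LocalFrame ι p T U A f w W L K r T₁) (ha : 0 ≤ a)
    (has : a ≤ s) (hsT : s ≤ T) (hs : s ≤ a + T₁)
    (h : IsYFun ι p (Icc a s) (fun t => TraceSpace.incl ι p (d t)) ω ν)
    (h0 : ‖d a‖ ≤ r / (8 * K))
    (he : ∀ᵐ t ∂(volume.restrict (Icc a s)),
      ν t - A a (w a) (ω t) = frozenRemainder A f w W a d ω t) :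
    pnorm p (Icc a s) ω + pnorm p (Icc a s) ν ≤ r := by
  have hK : 0 < K := zero_lt_one.trans_le F.one_le_K
  have hr := F.r_pos
  have h0r : (2 + 2 * K) * ‖d a‖ ≤ r / 2 := by
    have h1 : (2 + 2 * K) * ‖d a‖ ≤ (4 * K) * (r / (8 * K)) :=
      mul_le_mul (by linarith [F.one_le_K]) h0 (norm_nonneg _) (by positivity)
    have h2 : (4 * K) * (r / (8 * K)) = r / 2 := by field_simp; ring
    linarith
  have h0' : ‖d a‖ ≤ r := by nlinarith [norm_nonneg (d a)]
  -- Comparison with the zero solution improves the bound `r` to `r / 2`, because `h0` makes `(2 + 2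
  -- * K) * ‖d a‖` at most `r / 2`.
  have key : ∀ t ∈ Icc a s, pnorm p (Icc a t) ω + pnorm p (Icc a t) ν ≤ r →
      pnorm p (Icc a t) ω + pnorm p (Icc a t) ν ≤ r / 2 := by
    intro t ht hle
    have hsub : Icc a t ⊆ Icc a s := Icc_subset_Icc_right ht.2
    have hz : IsYFun ι p (Icc a t) (fun t => TraceSpace.incl ι p ((fun _ => 0) t))
      (fun _ => (0 : E₁)) (fun _ => (0 : E₀)) := by simpa using IsYFun.zero
    have := F.diff_bound ha ht.1 (ht.2.trans hsT) (ht.2.trans hs) (h.mono hsub) hz hle h0'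
      (by simpa [pnorm_zero] using hr.le) (by simpa using hr.le)
      (ae_mono (Measure.restrict_mono_set volume hsub) he)
      (by rw [frozenRemainder_zero]; simp)
    have e1 : ω - (fun _ => (0 : E₁)) = ω := by ext; simp
    have e2 : ν - (fun _ => (0 : E₀)) = ν := by ext; simp
    rw [e1, e2, sub_zero] at this
    linarith
  -- The norm on `[a, t]` is continuous in `t` and starts from 0. To exceed `r` it would have to
  -- take the value `r`, which `key` forbids.
  by_contra! hlt
  have hcont : ContinuousOn (fun t => pnorm p (Icc a t) ω + pnorm p (Icc a t) ν) (Icc a s) :=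
    (continuousOn_pnorm_Icc h.memLp_fun).add (continuousOn_pnorm_Icc h.memLp_deriv)
  obtain ⟨t, ht, hteq⟩ := intermediate_value_Icc has hcont
    (show r ∈ Icc _ _ from ⟨by simpa [pnorm] using hr.le, hlt.le⟩)
  have := key t ht hteq.le
  simp only at hteq
  linarith

/-- Solvability of the equation satisfied by the difference to the reference solution. -/
theorem exists_diff [CompleteSpace E₀] (F : LocalFrame ι p T U A f w W L K r T₁) (ha : 0 ≤ a)
    (has : a ≤ s) (hsT : s ≤ T) (hs : s ≤ a + T₁) (x : TraceSpace ι p)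
    (hx : ‖x‖ ≤ r / (8 * K)) :
    ∃ (d : ℝ → TraceSpace ι p) (ω : ℝ → E₁) (ν : ℝ → E₀),
      IsYFun ι p (Icc a s) (fun t => TraceSpace.incl ι p (d t)) ω ν ∧ d a = x ∧
      (∀ t ∈ Icc a s, w t + d t ∈ U) ∧
      ∀ᵐ t ∂(volume.restrict (Icc a s)),
        ν t - A a (w a) (ω t) = frozenRemainder A f w W a d ω t := by
  classical
  have hK1 := F.one_le_K
  have hK : 0 < K := zero_lt_one.trans_le hK1
  have hr := F.r_pos
  have haT : a ∈ Icc 0 T := ⟨ha, has.trans hsT⟩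
  have hsa : s - a ≤ T := by linarith [F.T₁_le]
  have hxr : ‖x‖ ≤ r := hx.trans (div_le_self hr.le (by linarith))
  set R := r / (8 * K) with hR
  have hRK : K * R = r / 8 := by rw [hR]; field_simp
  -- The unknown of the fixed point problem is the right-hand side `h` of the frozen linear problem.
  -- `Ψ` maps `h` to the remainder of the corresponding solution, and a fixed point of `Ψ` is a
  -- solution of the nonlinear equation.
  set H := Lp E₀ (ENNReal.ofReal p) (volume.restrict (Icc a s)) with hH
  have hsol : ∀ h : H, ∃ (d : ℝ → TraceSpace ι p) (ω : ℝ → E₁) (ν : ℝ → E₀),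
      IsYFun ι p (Icc a s) (fun t => TraceSpace.incl ι p (d t)) ω ν ∧ d a = x ∧
      ∀ᵐ t ∂(volume.restrict (Icc a s)), ν t - A a (w a) (ω t) = h t := fun h =>
    (F.maxReg a haT).exists_solution hsa x (Lp.memLp h)
  choose d ω ν hY hd0 heq using hsol
  have hnr : ∀ h : H, ‖h‖ ≤ 3 * R →
      pnorm p (Icc a s) (ω h) + pnorm p (Icc a s) (ν h) ≤ K * (‖h‖ + ‖x‖) := by
    intro h hh
    have hb := F.bound a haT a s _ _ _ has hsa (hY h)
    rwa [pnorm_congr_ae (heq h), hd0 h, show pnorm p (Icc a s) h = ‖h‖ from (Lp.norm_def h).symm]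
      at hb
  have hnr' : ∀ h : H, ‖h‖ ≤ 3 * R → pnorm p (Icc a s) (ω h) + pnorm p (Icc a s) (ν h) ≤ r := by
    intro h hh
    have h1 := hnr h hh
    have h2 : K * (‖h‖ + ‖x‖) ≤ K * (4 * R) := mul_le_mul_of_nonneg_left (by linarith) hK.le
    linarith
  have hmem : ∀ h : H, ‖h‖ ≤ 3 * R → MemLp (frozenRemainder A f w W a (d h) (ω h))
      (ENNReal.ofReal p) (volume.restrict (Icc a s)) := fun h hh =>
    F.memLp_frozenRemainder ha hsT (hY h) (hnr' h hh) (by rwa [hd0 h])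
  -- Outside the ball of radius `3 * R` the remainder need not be in `L^p`; the value 0 chosen in
  -- that case plays no role.
  let Ψ : H → H := fun h =>
    if hm : MemLp (frozenRemainder A f w W a (d h) (ω h)) (ENNReal.ofReal p)
      (volume.restrict (Icc a s)) then hm.toLp _ else 0
  have hΨ : ∀ h (hh : ‖h‖ ≤ 3 * R), Ψ h = (hmem h hh).toLp _ := fun h hh => dif_pos (hmem h hh)
  -- Comparison with the zero function gives `‖Ψ h‖ ≤ (‖h‖ + ‖x‖) / 2 + ‖x‖`. With `‖x‖ ≤ R` this
  -- preserves the radius `3 * R`, and `K * (3 * R + R) = r / 2` keeps the solutions within the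
  -- range of the estimates.
  have hmaps : MapsTo Ψ (Metric.closedBall 0 (3 * R)) (Metric.closedBall 0 (3 * R)) := by
    intro h hh
    rw [mem_closedBall_zero_iff] at hh ⊢
    have hz : IsYFun ι p (Icc a s) (fun t => TraceSpace.incl ι p ((fun _ => 0) t))
      (fun _ => (0 : E₁)) (fun _ => (0 : E₀)) := by simpa using IsYFun.zero
    have h1 := F.pnorm_frozenRemainder_sub_le ha has hsT hs (hY h) hz (hnr' h hh)
      (by rwa [hd0 h]) (by simpa [pnorm_zero] using hr.le) (by simpa using hr.le)
    have e1 : ω h - (fun _ => (0 : E₁)) = ω h := by ext; simp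
    have e2 : ν h - (fun _ => (0 : E₀)) = ν h := by ext; simp
    rw [frozenRemainder_zero, sub_zero, e1, e2, sub_zero, hd0 h] at h1
    rw [hΨ h hh, Lp.norm_toLp]
    change pnorm p (Icc a s) (frozenRemainder A f w W a (d h) (ω h)) ≤ _
    have h2 := mul_le_mul_of_nonneg_left (add_le_add_left (hnr h hh) (2 * ‖x‖))
      (by positivity : 0 ≤ 1 / (2 * K))
    have h3 : 1 / (2 * K) * (K * (‖h‖ + ‖x‖) + 2 * ‖x‖) = (‖h‖ + ‖x‖) / 2 + ‖x‖ / K := by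
      field_simp
    have h4 : ‖x‖ / K ≤ ‖x‖ := div_le_self (norm_nonneg _) hK1
    linarith
  -- Both solutions start at `x`, so the initial value terms drop out and the constant is `1 / (2 *
  -- K) * K`.
  have hlip : ∀ h₁ h₂ : H, ‖h₁‖ ≤ 3 * R → ‖h₂‖ ≤ 3 * R → ‖Ψ h₁ - Ψ h₂‖ ≤ 1 / 2 * ‖h₁ - h₂‖ := by
    intro h₁ h₂ hh₁ hh₂
    have h1 := F.pnorm_frozenRemainder_sub_le ha has hsT hs (hY h₁) (hY h₂) (hnr' h₁ hh₁)
      (by rwa [hd0]) (hnr' h₂ hh₂) (by rwa [hd0])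
    have h12 : IsYFun ι p (Icc a s) (fun t => TraceSpace.incl ι p ((d h₁ - d h₂) t))
        (ω h₁ - ω h₂) (ν h₁ - ν h₂) := by
      simpa [Pi.sub_def] using (hY h₁).sub (hY h₂)
    have hb := F.bound a haT a s _ _ _ has hsa h12
    have hc : pnorm p (Icc a s) (fun t => (ν h₁ - ν h₂) t - A a (w a) ((ω h₁ - ω h₂) t)) =
        ‖h₁ - h₂‖ := by
      rw [Lp.norm_def]
      refine pnorm_congr_ae ?_
      filter_upwards [heq h₁, heq h₂, Lp.coeFn_sub h₁ h₂] with t e₁ e₂ e₃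
      rw [e₃, Pi.sub_apply, Pi.sub_apply, Pi.sub_apply, ← e₁, ← e₂, map_sub]
      abel
    rw [hc, Pi.sub_apply, hd0, hd0, sub_self, norm_zero, add_zero] at hb
    rw [hd0, hd0, sub_self, norm_zero, mul_zero, add_zero] at h1
    rw [hΨ h₁ hh₁, hΨ h₂ hh₂, ← MemLp.toLp_sub, Lp.norm_toLp]
    refine h1.trans ((mul_le_mul_of_nonneg_left hb (by positivity)).trans_eq ?_)
    field_simp
  have hcontr : ContractingWith (1 / 2) (hmaps.restrict Ψ _ _) := by
    refine ⟨by rw [← NNReal.coe_lt_coe]; norm_num, LipschitzWith.of_dist_le_mul ?_⟩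
    rintro ⟨h₁, hh₁⟩ ⟨h₂, hh₂⟩
    rw [mem_closedBall_zero_iff] at hh₁ hh₂
    have := hlip h₁ h₂ hh₁ hh₂
    rw [← dist_eq_norm, ← dist_eq_norm] at this
    simpa [Subtype.dist_eq] using this
  obtain ⟨h, hmemh, hfix, -⟩ := hcontr.exists_fixedPoint' Metric.isClosed_closedBall.isComplete
    hmaps (x := 0) (Metric.mem_closedBall_self (by positivity)) (edist_ne_top _ _)
  rw [mem_closedBall_zero_iff] at hmemh
  refine ⟨d h, ω h, ν h, hY h, hd0 h, fun t ht => ?_, ?_⟩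
  · exact F.mem_ball ⟨ha.trans ht.1, ht.2.trans hsT⟩
      (norm_le_five (hY h) (hnr' h hmemh) (by rwa [hd0 h]) ht)
  · have h1 := (hmem h hmemh).coeFn_toLp
    rw [← hΨ h hmemh, hfix.eq] at h1
    filter_upwards [heq h, h1] with t e₁ e₂
    rw [e₁, e₂]

end LocalFrame

end Quasilinear

/-! ### Restriction and concatenation of strict solutions -/

section Gluing

variable {E₀ E₁ : Type*} [NormedAddCommGroup E₀] [NormedSpace ℂ E₀]
  [NormedAddCommGroup E₁] [NormedSpace ℂ E₁] {ι : E₁ →L[ℂ] E₀} {p : ℝ} [Fact (1 < p)]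
  {a b c : ℝ}

theorem ae_restrict_Icc_of_Icc_Icc {P : ℝ → Prop}
    (h₁ : ∀ᵐ t ∂(volume.restrict (Icc a b)), P t) (h₂ : ∀ᵐ t ∂(volume.restrict (Icc b c)), P t) :
    ∀ᵐ t ∂(volume.restrict (Icc a c)), P t := by
  rw [ae_restrict_iff' measurableSet_Icc] at *
  filter_upwards [h₁, h₂] with t h₁ h₂ ht
  rcases le_total t b with h | h
  · exact h₁ ⟨ht.1, h⟩
  · exact h₂ ⟨h, ht.2⟩

omit [Fact (1 < p)] in
theorem memLp_Icc_of_Icc_Icc {F : Type*} [NormedAddCommGroup F] {h : ℝ → F}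
    (h₁ : MemLp h (ENNReal.ofReal p) (volume.restrict (Icc a b)))
    (h₂ : MemLp h (ENNReal.ofReal p) (volume.restrict (Icc b c))) :
    MemLp h (ENNReal.ofReal p) (volume.restrict (Icc a c)) := by
  have := MemLp.piecewise (s := Iic b) (μ := volume.restrict (Icc a c)) (f := h) (g := h)
    (p := ENNReal.ofReal p) measurableSet_Iic
    (by
      rw [Measure.restrict_restrict measurableSet_Iic]
      exact h₁.restrict_mono_set fun t ht => ⟨ht.2.1, ht.1⟩)
    (by
      rw [Measure.restrict_restrict measurableSet_Iic.compl]
      exact h₂.restrict_mono_set fun t ht => ⟨le_of_not_ge ht.1, ht.2.2⟩)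
  rwa [piecewise_same] at this

variable {u v v' : ℝ → E₀} {w w' : ℝ → E₁}

omit [Fact (1 < p)] in
theorem IsYFun.congr_ae (h : IsYFun ι p (Icc a b) u w v)
    (hw : w =ᵐ[volume.restrict (Icc a b)] w') (hv : v =ᵐ[volume.restrict (Icc a b)] v') :
    IsYFun ι p (Icc a b) u w' v' where
  memLp_fun := h.memLp_fun.ae_eq hw
  memLp_deriv := h.memLp_deriv.ae_eq hv
  ae_eq := by
    filter_upwards [h.ae_eq, hw] with t h1 h2
    rw [h1, h2]
  sub_eq t₁ h₁ t₂ h₂ := by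
    rw [h.sub_eq t₁ h₁ t₂ h₂]
    refine intervalIntegral.integral_congr_ae ?_
    filter_upwards [(ae_restrict_iff' measurableSet_Icc).1 hv] with t ht htm
    exact ht (uIcc_subset_Icc h₁ h₂ (uIoc_subset_uIcc htm))

theorem IsYFun.union (hab : a ≤ b) (hbc : b ≤ c) (h₁ : IsYFun ι p (Icc a b) u w v)
    (h₂ : IsYFun ι p (Icc b c) u w v) : IsYFun ι p (Icc a c) u w v where
  memLp_fun := memLp_Icc_of_Icc_Icc h₁.memLp_fun h₂.memLp_fun
  memLp_deriv := memLp_Icc_of_Icc_Icc h₁.memLp_deriv h₂.memLp_deriv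
  ae_eq := ae_restrict_Icc_of_Icc_Icc h₁.ae_eq h₂.ae_eq
  sub_eq t₁ ht₁ t₂ ht₂ := by
    have hb : b ∈ Icc a c := ⟨hab, hbc⟩
    have hv := memLp_Icc_of_Icc_Icc h₁.memLp_deriv h₂.memLp_deriv
    have key : ∀ t ∈ Icc a c, u t - u b = ∫ s in b..t, v s := by
      intro t ht
      rcases le_total t b with h | h
      · exact h₁.sub_eq b ⟨hab, le_rfl⟩ t ⟨ht.1, h⟩
      · exact h₂.sub_eq b ⟨le_rfl, hbc⟩ t ⟨h, ht.2⟩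
    rw [← intervalIntegral.integral_interval_sub_left (intervalIntegrable_of_memLp hv hb ht₂)
      (intervalIntegrable_of_memLp hv hb ht₁), ← key t₁ ht₁, ← key t₂ ht₂]
    abel

variable {U : Set (TraceSpace ι p)} {A : ℝ → TraceSpace ι p → E₁ →L[ℂ] E₀}
  {f : ℝ → TraceSpace ι p → E₀} {g : ℝ → E₀} {u₀ : TraceSpace ι p}

theorem IsStrictSolution.mono {y : ℝ → TraceSpace ι p} {a' b' : ℝ}
    (h : IsStrictSolution ι p U A f g a b u₀ y) (hsub : Icc a' b' ⊆ Icc a b) :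
    IsStrictSolution ι p U A f g a' b' (y a') y := by
  obtain ⟨-, hU, w, v, hY, hA, hf, hg, he⟩ := h
  exact ⟨rfl, fun t ht => hU t (hsub ht), w, v, hY.mono hsub, hA.restrict_mono_set hsub,
    hf.restrict_mono_set hsub, hg.restrict_mono_set hsub,
    ae_mono (Measure.restrict_mono_set volume hsub) he⟩

theorem IsStrictSolution.congr {y z : ℝ → TraceSpace ι p}
    (h : IsStrictSolution ι p U A f g a b u₀ y) (hab : a ≤ b) (hz : EqOn z y (Icc a b)) :
    IsStrictSolution ι p U A f g a b u₀ z := by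
  obtain ⟨h0, hU, w, v, hY, hA, hf, hg, he⟩ := h
  have hae : ∀ᵐ t ∂(volume.restrict (Icc a b)), y t = z t := by
    filter_upwards [ae_restrict_mem measurableSet_Icc] with t ht using (hz ht).symm
  refine ⟨(hz ⟨le_rfl, hab⟩).trans h0, fun t ht => hz ht ▸ hU t ht, w, v,
    hY.congr measurableSet_Icc fun t ht => by simp only [hz ht], hA.ae_eq ?_, hf.ae_eq ?_, hg, ?_⟩
  · filter_upwards [hae] with t ht
    rw [ht]
  · filter_upwards [hae] with t ht
    rw [ht]
  · filter_upwards [he, hae] with t h1 h2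
    rw [← h2, h1]

theorem IsStrictSolution.union {y : ℝ → TraceSpace ι p} (hab : a ≤ b) (hbc : b ≤ c)
    (h₁ : IsStrictSolution ι p U A f g a b u₀ y)
    (h₂ : IsStrictSolution ι p U A f g b c (y b) y) :
    IsStrictSolution ι p U A f g a c u₀ y := by
  obtain ⟨h0, hU₁, w₁, v₁, hY₁, hA₁, hf₁, hg₁, he₁⟩ := h₁
  obtain ⟨-, hU₂, w₂, v₂, hY₂, hA₂, hf₂, hg₂, he₂⟩ := h₂
  -- The representatives from the two sides may disagree at `b`, which affects only a null set.
  set w : ℝ → E₁ := fun t => if t ≤ b then w₁ t else w₂ t with hw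
  set v : ℝ → E₀ := fun t => if t ≤ b then v₁ t else v₂ t with hv
  have hne : ∀ᵐ t : ℝ ∂(volume.restrict (Icc b c)), b < t := by
    have h1 : ∀ᵐ t : ℝ, t ≠ b := by simp [ae_iff]
    filter_upwards [ae_restrict_of_ae h1, ae_restrict_mem measurableSet_Icc] with t h1 h2
    exact lt_of_le_of_ne h2.1 h1.symm
  have ew₁ : w₁ =ᵐ[volume.restrict (Icc a b)] w := by
    filter_upwards [ae_restrict_mem measurableSet_Icc] with t ht
    simp [w, ht.2]
  have ev₁ : v₁ =ᵐ[volume.restrict (Icc a b)] v := by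
    filter_upwards [ae_restrict_mem measurableSet_Icc] with t ht
    simp [v, ht.2]
  have ew₂ : w₂ =ᵐ[volume.restrict (Icc b c)] w := by
    filter_upwards [hne] with t ht
    simp [w, ht.not_ge]
  have ev₂ : v₂ =ᵐ[volume.restrict (Icc b c)] v := by
    filter_upwards [hne] with t ht
    simp [v, ht.not_ge]
  refine ⟨h0, fun t ht => ?_, w, v, (hY₁.congr_ae ew₁ ev₁).union hab hbc (hY₂.congr_ae ew₂ ev₂),
    memLp_Icc_of_Icc_Icc (hA₁.ae_eq ?_) (hA₂.ae_eq ?_), memLp_Icc_of_Icc_Icc hf₁ hf₂,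
    memLp_Icc_of_Icc_Icc hg₁ hg₂, ae_restrict_Icc_of_Icc_Icc (b := b) ?_ ?_⟩
  · rcases le_total t b with h | h
    · exact hU₁ t ⟨ht.1, h⟩
    · exact hU₂ t ⟨h, ht.2⟩
  · filter_upwards [ew₁] with t ht
    rw [ht]
  · filter_upwards [ew₂] with t ht
    rw [ht]
  · filter_upwards [he₁, ew₁, ev₁] with t h1 h2 h3
    rw [← h2, ← h3, h1]
  · filter_upwards [he₂, ew₂, ev₂] with t h1 h2 h3
    rw [← h2, ← h3, h1]

theorem IsStrictSolution.exists_concat {y z : ℝ → TraceSpace ι p} (hab : a ≤ b) (hbc : b ≤ c)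
    (h₁ : IsStrictSolution ι p U A f g a b u₀ y)
    (h₂ : IsStrictSolution ι p U A f g b c (y b) z) :
    ∃ x, IsStrictSolution ι p U A f g a c u₀ x := by
  refine ⟨fun t => if t ≤ b then y t else z t, IsStrictSolution.union hab hbc
    (h₁.congr hab fun t ht => if_pos ht.2) ?_⟩
  simp only [le_refl, if_true]
  refine h₂.congr hbc fun t ht => ?_
  rcases ht.1.eq_or_lt with rfl | h
  · simp [h₂.1]
  · simp [h.not_ge]

theorem IsStrictSolution.continuousOn {y : ℝ → TraceSpace ι p}
    (h : IsStrictSolution ι p U A f g a b u₀ y) : ContinuousOn y (Icc a b) := by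
  obtain ⟨-, -, w, v, hY, -⟩ := h
  exact TraceSpace.continuousOn hY

end Gluing

/-! ### Local well-posedness along the reference solution -/

namespace LocalFrame

variable {E₀ E₁ : Type*} [NormedAddCommGroup E₀] [NormedSpace ℂ E₀]
  [NormedAddCommGroup E₁] [NormedSpace ℂ E₁] {ι : E₁ →L[ℂ] E₀} {p : ℝ} [Fact (1 < p)]
  {T : ℝ} {U : Set (TraceSpace ι p)} {A : ℝ → TraceSpace ι p → E₁ →L[ℂ] E₀}
  {f : ℝ → TraceSpace ι p → E₀} {g : ℝ → E₀} {w : ℝ → TraceSpace ι p} {W : ℝ → E₁} {V : ℝ → E₀}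
  {L K r T₁ a s : ℝ} {u₀ u₀₁ u₀₂ : TraceSpace ι p} {u u₁ u₂ : ℝ → TraceSpace ι p}

theorem exists_isStrictSolution [CompleteSpace E₀] (F : LocalFrame ι p T U A f w W L K r T₁)
    (hg : MemLp g (ENNReal.ofReal p) (volume.restrict (Icc 0 T)))
    (hw : IsYFun ι p (Icc 0 T) (fun t => TraceSpace.incl ι p (w t)) W V)
    (hwe : ∀ᵐ t ∂(volume.restrict (Icc 0 T)), V t - A t (w t) (W t) = f t (w t) + g t)
    (ha : 0 ≤ a) (has : a ≤ s) (hsT : s ≤ T) (hs : s ≤ a + T₁)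
    (hu₀ : ‖u₀ - w a‖ ≤ r / (8 * K)) :
    ∃ u, IsStrictSolution ι p U A f g a s u₀ u := by
  obtain ⟨d, ω, ν, hY, hd0, hU, he⟩ := F.exists_diff ha has hsT hs _ hu₀
  have hsub : Icc a s ⊆ Icc 0 T := Icc_subset_Icc ha hsT
  have hYu : IsYFun ι p (Icc a s) (fun t => TraceSpace.incl ι p (w t + d t)) (W + ω) (V + ν) := by
    simpa [Pi.add_def] using (hw.mono hsub).add_of_ordConnected hY
  have hc := TraceSpace.continuousOn hYu
  refine ⟨fun t => w t + d t, by simp [hd0], hU, W + ω, V + ν, hYu,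
    (continuousOn_of_lip F.A_lip hsub hc hU).memLp_clm_apply hYu.memLp_fun,
    (continuousOn_of_lip F.f_lip hsub hc hU).memLp_Icc, hg.restrict_mono_set hsub, ?_⟩
  filter_upwards [he, ae_mono (Measure.restrict_mono_set volume hsub) hwe] with t h1 h2
  rw [frozenRemainder, sub_eq_iff_eq_add] at h1
  rw [sub_eq_iff_eq_add] at h2
  simp only [Pi.add_apply]
  rw [h1, h2]
  abel

/-- This makes the estimates for differences available for every strict solution, not only for those
obtained from the contraction; uniqueness depends on it. -/
theorem exists_diff_of_isStrictSolution
    (hw : IsYFun ι p (Icc 0 T) (fun t => TraceSpace.incl ι p (w t)) W V)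
    (hwe : ∀ᵐ t ∂(volume.restrict (Icc 0 T)), V t - A t (w t) (W t) = f t (w t) + g t)
    (ha : 0 ≤ a) (hsT : s ≤ T) (h : IsStrictSolution ι p U A f g a s u₀ u) :
    ∃ (ω : ℝ → E₁) (ν : ℝ → E₀),
      IsYFun ι p (Icc a s) (fun t => TraceSpace.incl ι p ((u - w) t)) ω ν ∧
      ∀ᵐ t ∂(volume.restrict (Icc a s)),
        ν t - A a (w a) (ω t) = frozenRemainder A f w W a (u - w) ω t := by
  obtain ⟨-, -, ωu, νu, hY, -, -, -, he⟩ := h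
  have hsub : Icc a s ⊆ Icc 0 T := Icc_subset_Icc ha hsT
  refine ⟨ωu - W, νu - V, by simpa [Pi.sub_def] using hY.sub (hw.mono hsub), ?_⟩
  filter_upwards [he, ae_mono (Measure.restrict_mono_set volume hsub) hwe] with t h1 h2
  rw [sub_eq_iff_eq_add] at h1 h2
  simp only [frozenRemainder, Pi.sub_apply, add_sub_cancel]
  rw [h1, h2]
  abel

/-- `LocalFrame.a_priori_bound` brings both solutions into the range of `LocalFrame.diff_bound`. The
constant is the 4 of the trace estimate plus the `2 + 2 * K` of the difference bound. -/
theorem norm_sub_le (F : LocalFrame ι p T U A f w W L K r T₁)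
    (hw : IsYFun ι p (Icc 0 T) (fun t => TraceSpace.incl ι p (w t)) W V)
    (hwe : ∀ᵐ t ∂(volume.restrict (Icc 0 T)), V t - A t (w t) (W t) = f t (w t) + g t)
    (ha : 0 ≤ a) (has : a ≤ s) (hsT : s ≤ T) (hs : s ≤ a + T₁)
    (hu₀₁ : ‖u₀₁ - w a‖ ≤ r / (8 * K)) (hu₀₂ : ‖u₀₂ - w a‖ ≤ r / (8 * K))
    (h₁ : IsStrictSolution ι p U A f g a s u₀₁ u₁) (h₂ : IsStrictSolution ι p U A f g a s u₀₂ u₂)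
    {t : ℝ} (ht : t ∈ Icc a s) : ‖u₁ t - u₂ t‖ ≤ (6 + 2 * K) * ‖u₀₁ - u₀₂‖ := by
  obtain ⟨ω₁, ν₁, hY₁, he₁⟩ := exists_diff_of_isStrictSolution hw hwe ha hsT h₁
  obtain ⟨ω₂, ν₂, hY₂, he₂⟩ := exists_diff_of_isStrictSolution hw hwe ha hsT h₂
  have hR : r / (8 * K) ≤ r := div_le_self F.r_pos.le (by linarith [F.one_le_K])
  have h0₁ : ‖(u₁ - w) a‖ ≤ r / (8 * K) := by rwa [Pi.sub_apply, h₁.1]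
  have h0₂ : ‖(u₂ - w) a‖ ≤ r / (8 * K) := by rwa [Pi.sub_apply, h₂.1]
  have hd := F.diff_bound ha has hsT hs hY₁ hY₂
    (F.a_priori_bound ha has hsT hs hY₁ h0₁ he₁) (h0₁.trans hR)
    (F.a_priori_bound ha has hsT hs hY₂ h0₂ he₂) (h0₂.trans hR) he₁ he₂
  have h12 : IsYFun ι p (Icc a s) (fun t => TraceSpace.incl ι p ((u₁ - u₂) t)) (ω₁ - ω₂)
      (ν₁ - ν₂) := by
    simpa [Pi.sub_def] using hY₁.sub hY₂
  have ht := TraceSpace.norm_apply_le h12 ht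
  rw [Pi.sub_apply, Pi.sub_apply, h₁.1, h₂.1] at ht
  rw [Pi.sub_apply, Pi.sub_apply, sub_sub_sub_cancel_right, h₁.1, h₂.1] at hd
  linarith

theorem norm_sub_le_of_lipschitzOnWith {F : Type*} [NormedAddCommGroup F]
    {φ : ℝ → TraceSpace ι p → F} {C : NNReal} (hC : (C : ℝ) ≤ L)
    (h : LipschitzOnWith C (fun q : ℝ × TraceSpace ι p => φ q.1 q.2) (Icc 0 T ×ˢ U)) :
    ∀ t ∈ Icc 0 T, ∀ t' ∈ Icc 0 T, ∀ x ∈ U, ∀ x' ∈ U,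
      ‖φ t x - φ t' x'‖ ≤ L * (|t - t'| + ‖x - x'‖) := by
  intro t ht t' ht' x hx x' hx'
  have h1 := h.dist_le_mul (t, x) ⟨ht, hx⟩ (t', x') ⟨ht', hx'⟩
  rw [dist_eq_norm, Prod.dist_eq, Real.dist_eq, dist_eq_norm] at h1
  exact h1.trans (mul_le_mul hC (max_le_add_of_nonneg (abs_nonneg _) (norm_nonneg _))
    (le_max_of_le_left (abs_nonneg _)) (C.coe_nonneg.trans hC))

/-- Existence of uniform data for the local theory. -/
theorem exists_localFrame [CompleteSpace E₀] [CompleteSpace E₁] (hι : Function.Injective ι)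
    (hT : 0 < T) (hU : IsOpen U)
    (hA : ∃ K, LipschitzOnWith K (fun q : ℝ × TraceSpace ι p => A q.1 q.2) (Icc 0 T ×ˢ U))
    (hf : ∃ K, LipschitzOnWith K (fun q : ℝ × TraceSpace ι p => f q.1 q.2) (Icc 0 T ×ˢ U))
    (hw : IsYFun ι p (Icc 0 T) (fun t => TraceSpace.incl ι p (w t)) W V)
    (hwU : ∀ t ∈ Icc 0 T, w t ∈ U)
    (hmr : ∀ t ∈ Icc 0 T, MaximalRegularity ι p T (A t (w t))) :
    ∃ L K r T₁, LocalFrame ι p T U A f w W L K r T₁ := by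
  obtain ⟨LA, hLA⟩ := hA
  obtain ⟨Lf, hLf⟩ := hf
  set L : ℝ := max LA Lf with hLdef
  have hL : 0 ≤ L := LA.coe_nonneg.trans (le_max_left _ _)
  have hA_lip := norm_sub_le_of_lipschitzOnWith (le_max_left (LA : ℝ) Lf) hLA
  have hf_lip := norm_sub_le_of_lipschitzOnWith (le_max_right (LA : ℝ) Lf) hLf
  have hwc := TraceSpace.continuousOn hw
  obtain ⟨K, hK1, hK⟩ := exists_uniform_hasMaxRegBound hι hT.le isCompact_Icc
    (continuousOn_of_lip hA_lip Subset.rfl hwc hwU) hmr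
  have hK0 : 0 < K := zero_lt_one.trans_le hK1
  -- The trajectory of `w` is compact in the trace space, so one radius `ρ` serves for all times.
  obtain ⟨ρ, hρ, hρU⟩ := (isCompact_Icc.image_of_continuousOn hwc).exists_cthickening_subset_open
    hU (image_subset_iff.2 hwU)
  set ε := 1 / (4 * K) with hε
  have hε0 : 0 < ε := by positivity
  have hL1 : 0 < L + 1 := by linarith
  -- With `r`, the oscillation of `w`, the time step and the `L^p` norm of `‖W‖ + 1` all at most
  -- `η`, the condition `osc` costs `7 * (L * η)` and `small` costs `2 * (L * η)`, both below `ε`.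
  -- The summand 1 covers the case `L = 0`.
  set η := ε / (10 * (L + 1)) with hη
  have hη0 : 0 < η := by positivity
  have hLη : 10 * (L * η) ≤ ε := by
    rw [hη]
    have : 10 * (L * (ε / (10 * (L + 1)))) = ε * (L / (L + 1)) := by field_simp
    rw [this]
    exact mul_le_of_le_one_right hε0.le (by rw [div_le_one hL1]; linarith)
  set r := min (ρ / 5) η with hr
  have hr0 : 0 < r := lt_min (by positivity) hη0
  have hLr : L * r ≤ L * η := mul_le_mul_of_nonneg_left (min_le_right _ _) hL
  obtain ⟨δ₁, hδ₁, hunif⟩ := Metric.uniformContinuousOn_iff.1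
    (isCompact_Icc.uniformContinuousOn_of_continuous hwc) η hη0
  have he : MemLp (fun t => ‖W t‖ + 1) (ENNReal.ofReal p) (volume.restrict (Icc 0 T)) :=
    hw.memLp_fun.norm.add (memLp_const 1)
  obtain ⟨δ₂, hδ₂, hsmall⟩ := exists_pnorm_Icc_le he hη0
  set T₁ := min (min T (δ₁ / 2)) (min η δ₂) with hT₁
  have hT₁T : T₁ ≤ T := (min_le_left _ _).trans (min_le_left _ _)
  have hT₁δ₁ : T₁ ≤ δ₁ / 2 := (min_le_left _ _).trans (min_le_right _ _)
  have hT₁η : T₁ ≤ η := (min_le_right _ _).trans (min_le_left _ _)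
  have hT₁δ₂ : T₁ ≤ δ₂ := (min_le_right _ _).trans (min_le_right _ _)
  refine ⟨L, K, r, T₁, hL, hK1, hr0, lt_min (lt_min hT (by positivity)) (lt_min hη0 hδ₂), hT₁T,
    hwc, hw.memLp_fun, hA_lip, hf_lip, hmr, hK, fun t ht => ?_, fun a t ha hat htT htT₁ => ?_,
    fun a s ha has hsT hs => ?_⟩
  · refine (Metric.closedBall_subset_closedBall ?_).trans
      ((Metric.closedBall_subset_cthickening (mem_image_of_mem w ht) ρ).trans hρU)
    linarith [min_le_left (ρ / 5) η]
  · have h1 : ‖w t - w a‖ ≤ η := by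
      rw [← dist_eq_norm]
      refine (hunif t ⟨ha.trans hat, htT⟩ a ⟨ha, hat.trans htT⟩ ?_).le
      rw [Real.dist_eq, abs_of_nonneg (sub_nonneg.2 hat)]
      linarith
    have h2 : |t - a| ≤ η := by
      rw [abs_of_nonneg (sub_nonneg.2 hat)]
      linarith
    have h3 := mul_le_mul_of_nonneg_left (add_le_add h2 h1) hL
    have h4 : 0 ≤ L * η := by positivity
    linarith
  · have h1 := hsmall a s (Icc_subset_Icc ha hsT) (by linarith)
    have h2 := mul_le_mul_of_nonneg_left h1 hL
    have h4 : 0 ≤ L * η := by positivity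
    linarith

end LocalFrame

/-! ### From local to global -/

section Global

variable {E₀ E₁ : Type*} [NormedAddCommGroup E₀] [NormedSpace ℂ E₀]
  [NormedAddCommGroup E₁] [NormedSpace ℂ E₁] {ι : E₁ →L[ℂ] E₀} {p : ℝ} [Fact (1 < p)]
  {T : ℝ} {U : Set (TraceSpace ι p)} {A : ℝ → TraceSpace ι p → E₁ →L[ℂ] E₀}
  {f : ℝ → TraceSpace ι p → E₀} {g : ℝ → E₀} {w : ℝ → TraceSpace ι p} {w₀ : TraceSpace ι p}
  {R₀ T₁ L₁ : ℝ}

/-- Induction on the number `k` of steps of length `T₁` needed to reach `T`. A step multiplies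
distances by at most `L₁`, so the radius `R₀ / L₁ ^ (k + 1)` becomes `R₀ / L₁ ^ k`, as the remaining
`k` steps require. The case `k = 0` is void because `t₀ < T`. -/
theorem norm_sub_le_of_local (hw : IsStrictSolution ι p U A f g 0 T w₀ w)
    (hR₀ : 0 < R₀) (hT₁ : 0 < T₁) (hL₁ : 1 ≤ L₁)
    (hlip : ∀ t₀ t₁ : ℝ, 0 ≤ t₀ → t₀ < t₁ → t₁ ≤ T → t₁ ≤ t₀ + T₁ →
      ∀ u₀₁ ∈ Metric.closedBall (w t₀) R₀, ∀ u₀₂ ∈ Metric.closedBall (w t₀) R₀,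
      ∀ u₁ u₂ : ℝ → TraceSpace ι p, IsStrictSolution ι p U A f g t₀ t₁ u₀₁ u₁ →
      IsStrictSolution ι p U A f g t₀ t₁ u₀₂ u₂ →
      ∀ t ∈ Icc t₀ t₁, ‖u₁ t - u₂ t‖ ≤ L₁ * ‖u₀₁ - u₀₂‖)
    (k : ℕ) : ∀ t₀, 0 ≤ t₀ → t₀ < T → T - t₀ ≤ k * T₁ →
      ∀ u₀₁ ∈ Metric.closedBall (w t₀) (R₀ / L₁ ^ k),
      ∀ u₀₂ ∈ Metric.closedBall (w t₀) (R₀ / L₁ ^ k),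
      ∀ u₁ u₂ : ℝ → TraceSpace ι p, IsStrictSolution ι p U A f g t₀ T u₀₁ u₁ →
      IsStrictSolution ι p U A f g t₀ T u₀₂ u₂ →
      ∀ t ∈ Icc t₀ T, ‖u₁ t - u₂ t‖ ≤ L₁ ^ k * ‖u₀₁ - u₀₂‖ := by
  induction k with
  | zero =>
    intro t₀ _ h1 h2
    rw [Nat.cast_zero, zero_mul] at h2
    linarith
  | succ k ih =>
    intro t₀ ht₀ ht₀T hk u₀₁ hu₀₁ u₀₂ hu₀₂ u₁ u₂ h₁ h₂ t ht
    have hL0 : 0 < L₁ := zero_lt_one.trans_le hL₁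
    have hball : Metric.closedBall (w t₀) (R₀ / L₁ ^ (k + 1)) ⊆ Metric.closedBall (w t₀) R₀ :=
      Metric.closedBall_subset_closedBall (div_le_self hR₀.le (one_le_pow₀ hL₁))
    have hpow : L₁ ≤ L₁ ^ (k + 1) := le_self_pow₀ hL₁ (Nat.succ_ne_zero k)
    have hmono := mul_le_mul_of_nonneg_right hpow (norm_nonneg (u₀₁ - u₀₂))
    rcases le_or_gt T (t₀ + T₁) with hT | hT
    · exact (hlip t₀ T ht₀ ht₀T le_rfl hT _ (hball hu₀₁) _ (hball hu₀₂) u₁ u₂ h₁ h₂ t ht).trans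
        hmono
    · have hlt : t₀ < t₀ + T₁ := by linarith
      have hsub : Icc t₀ (t₀ + T₁) ⊆ Icc t₀ T := Icc_subset_Icc_right hT.le
      have hsub' : Icc (t₀ + T₁) T ⊆ Icc t₀ T := Icc_subset_Icc_left hlt.le
      have m₁ := h₁.mono hsub
      have m₂ := h₂.mono hsub
      rw [h₁.1] at m₁
      rw [h₂.1] at m₂
      have hloc := hlip t₀ _ ht₀ hlt hT.le le_rfl _ (hball hu₀₁) _ (hball hu₀₂) u₁ u₂ m₁ m₂
      rcases le_total t (t₀ + T₁) with htT | htT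
      · exact (hloc t ⟨ht.1, htT⟩).trans hmono
      · have hend : t₀ + T₁ ∈ Icc t₀ (t₀ + T₁) := ⟨hlt.le, le_rfl⟩
        have mw := hw.mono (Icc_subset_Icc ht₀ hT.le)
        -- The local Lipschitz estimate is applied to the pair `y`, `w`, the latter being a strict
        -- solution too.
        have hstay : ∀ x ∈ Metric.closedBall (w t₀) (R₀ / L₁ ^ (k + 1)),
            ∀ y : ℝ → TraceSpace ι p, IsStrictSolution ι p U A f g t₀ (t₀ + T₁) x y →
            y (t₀ + T₁) ∈ Metric.closedBall (w (t₀ + T₁)) (R₀ / L₁ ^ k) := by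
          intro x hx y hy
          have h3 := hlip t₀ _ ht₀ hlt hT.le le_rfl x (hball hx) _
            (Metric.mem_closedBall_self hR₀.le) y w hy mw _ hend
          rw [Metric.mem_closedBall, dist_eq_norm] at hx ⊢
          refine h3.trans ((mul_le_mul_of_nonneg_left hx hL0.le).trans_eq ?_)
          rw [pow_succ]
          field_simp
        have h4 := ih (t₀ + T₁) (by linarith) hT (by push_cast at hk; linarith)
          _ (hstay _ hu₀₁ _ m₁) _ (hstay _ hu₀₂ _ m₂) u₁ u₂ (h₁.mono hsub') (h₂.mono hsub')
          t ⟨htT, ht.2⟩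
        refine h4.trans ((mul_le_mul_of_nonneg_left (hloc _ hend) (by positivity)).trans_eq ?_)
        ring

/-- The same induction: comparison with `w` places the end point of a local solution in the smaller
ball demanded of the tail, and the two pieces are concatenated. -/
theorem exists_isStrictSolution_of_local (hw : IsStrictSolution ι p U A f g 0 T w₀ w)
    (hR₀ : 0 < R₀) (hT₁ : 0 < T₁) (hL₁ : 1 ≤ L₁)
    (hex : ∀ t₀ t₁ : ℝ, 0 ≤ t₀ → t₀ < t₁ → t₁ ≤ T → t₁ ≤ t₀ + T₁ →
      ∀ u₀ ∈ Metric.closedBall (w t₀) R₀, ∃ u, IsStrictSolution ι p U A f g t₀ t₁ u₀ u)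
    (hlip : ∀ t₀ t₁ : ℝ, 0 ≤ t₀ → t₀ < t₁ → t₁ ≤ T → t₁ ≤ t₀ + T₁ →
      ∀ u₀₁ ∈ Metric.closedBall (w t₀) R₀, ∀ u₀₂ ∈ Metric.closedBall (w t₀) R₀,
      ∀ u₁ u₂ : ℝ → TraceSpace ι p, IsStrictSolution ι p U A f g t₀ t₁ u₀₁ u₁ →
      IsStrictSolution ι p U A f g t₀ t₁ u₀₂ u₂ →
      ∀ t ∈ Icc t₀ t₁, ‖u₁ t - u₂ t‖ ≤ L₁ * ‖u₀₁ - u₀₂‖)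
    (k : ℕ) : ∀ t₀, 0 ≤ t₀ → t₀ < T → T - t₀ ≤ k * T₁ →
      ∀ u₀ ∈ Metric.closedBall (w t₀) (R₀ / L₁ ^ k),
      ∃ u, IsStrictSolution ι p U A f g t₀ T u₀ u := by
  induction k with
  | zero =>
    intro t₀ _ h1 h2
    rw [Nat.cast_zero, zero_mul] at h2
    linarith
  | succ k ih =>
    intro t₀ ht₀ ht₀T hk u₀ hu₀
    have hL0 : 0 < L₁ := zero_lt_one.trans_le hL₁
    have hu₀' : u₀ ∈ Metric.closedBall (w t₀) R₀ :=
      Metric.closedBall_subset_closedBall (div_le_self hR₀.le (one_le_pow₀ hL₁)) hu₀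
    rcases le_or_gt T (t₀ + T₁) with hT | hT
    · exact hex t₀ T ht₀ ht₀T le_rfl hT u₀ hu₀'
    · have hlt : t₀ < t₀ + T₁ := by linarith
      obtain ⟨y, hy⟩ := hex t₀ _ ht₀ hlt hT.le le_rfl u₀ hu₀'
      have h3 := hlip t₀ _ ht₀ hlt hT.le le_rfl u₀ hu₀' _ (Metric.mem_closedBall_self hR₀.le) y w
        hy (hw.mono (Icc_subset_Icc ht₀ hT.le)) _ ⟨hlt.le, le_rfl⟩
      obtain ⟨z, hz⟩ := ih (t₀ + T₁) (by linarith) hT (by push_cast at hk; linarith)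
        (y (t₀ + T₁)) (by
          rw [Metric.mem_closedBall, dist_eq_norm] at hu₀ ⊢
          refine h3.trans ((mul_le_mul_of_nonneg_left hu₀ hL0.le).trans_eq ?_)
          rw [pow_succ]
          field_simp)
      exact hy.exists_concat hlt.le hT.le hz

end Global

theorem theorem4p3 {E₀ E₁ : Type*}
    [NormedAddCommGroup E₀] [NormedSpace ℂ E₀] [CompleteSpace E₀]
    [NormedAddCommGroup E₁] [NormedSpace ℂ E₁] [CompleteSpace E₁]
    (ι : E₁ →L[ℂ] E₀) (hι_inj : Function.Injective ι) (hι_dense : DenseRange ι)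
    (p : ℝ) [Fact (1 < p)] (T : ℝ) (hT : 0 < T)
    (g : ℝ → E₀) (hg : MemLp g (ENNReal.ofReal p) (volume.restrict (Icc 0 T)))
    (U : Set (TraceSpace ι p)) (hU_open : IsOpen U) (hU_nonempty : U.Nonempty)
    (A : ℝ → TraceSpace ι p → E₁ →L[ℂ] E₀) (f : ℝ → TraceSpace ι p → E₀)
    (hA_lip : ∃ K, LipschitzOnWith K (fun q : ℝ × TraceSpace ι p => A q.1 q.2) (Icc 0 T ×ˢ U))
    (hA_mr : ∀ t ∈ Icc 0 T, ∀ x ∈ U, MaximalRegularity ι p T (A t x))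
    (hf_lip : ∃ K, LipschitzOnWith K (fun q : ℝ × TraceSpace ι p => f q.1 q.2) (Icc 0 T ×ˢ U))
    (w₀ : TraceSpace ι p) (w : ℝ → TraceSpace ι p)
    (hw : IsStrictSolution ι p U A f g 0 T w₀ w)
    (hw_mr : ∀ t ∈ Icc 0 T, MaximalRegularity ι p T (A t (w t))) :
    ∃ R₀ T₁ L₁ : ℝ, 0 < R₀ ∧ 0 < T₁ ∧ T₁ ≤ T ∧ 1 ≤ L₁ ∧
      -- the closed balls of radius `R₀` along `w` lie in `U`
      (∀ t ∈ Icc 0 T, Metric.closedBall (w t) R₀ ⊆ U) ∧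
      -- `T₁` and `L₁` are a local existence time and a local Lipschitz constant
      (∀ t₀ t₁ : ℝ, 0 ≤ t₀ → t₀ < t₁ → t₁ ≤ T → t₁ ≤ t₀ + T₁ →
        (∀ u₀ ∈ Metric.closedBall (w t₀) R₀, ∃ u : ℝ → TraceSpace ι p,
          IsStrictSolution ι p U A f g t₀ t₁ u₀ u ∧
          ∀ u' : ℝ → TraceSpace ι p, IsStrictSolution ι p U A f g t₀ t₁ u₀ u' →
            EqOn u' u (Icc t₀ t₁)) ∧
        (∀ u₀₁ ∈ Metric.closedBall (w t₀) R₀, ∀ u₀₂ ∈ Metric.closedBall (w t₀) R₀,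
          ∀ u₁ u₂ : ℝ → TraceSpace ι p,
          IsStrictSolution ι p U A f g t₀ t₁ u₀₁ u₁ →
          IsStrictSolution ι p U A f g t₀ t₁ u₀₂ u₂ →
          ∀ t ∈ Icc t₀ t₁, ‖u₁ t - u₂ t‖ ≤ L₁ * ‖u₀₁ - u₀₂‖)) ∧
      -- `m` is the smallest natural number with `m ≥ T / T₁`
      ∀ m : ℕ, m = ⌈T / T₁⌉₊ →
        -- (i) existence and uniqueness on `[t₀, T]`
        (∀ t₀ ∈ Ico 0 T, ∀ u₀ ∈ Metric.closedBall (w t₀) (R₀ / L₁ ^ m),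
          ∃ u : ℝ → TraceSpace ι p,
            IsStrictSolution ι p U A f g t₀ T u₀ u ∧
            ContinuousOn u (Icc t₀ T) ∧
            (∀ t ∈ Icc t₀ T, u t ∈ Metric.closedBall (w t) R₀) ∧
            ∀ u' : ℝ → TraceSpace ι p, IsStrictSolution ι p U A f g t₀ T u₀ u' →
              EqOn u' u (Icc t₀ T)) ∧
        -- (ii) Lipschitz dependence on the initial values
        (∀ t₀ ∈ Ico 0 T,
          ∀ u₀₁ ∈ Metric.closedBall (w t₀) (R₀ / L₁ ^ m),
          ∀ u₀₂ ∈ Metric.closedBall (w t₀) (R₀ / L₁ ^ m),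
          ∀ u₁ u₂ : ℝ → TraceSpace ι p,
          IsStrictSolution ι p U A f g t₀ T u₀₁ u₁ →
          IsStrictSolution ι p U A f g t₀ T u₀₂ u₂ →
          ∀ t ∈ Icc t₀ T,
            u₁ t ∈ Metric.closedBall (w t) R₀ ∧ u₂ t ∈ Metric.closedBall (w t) R₀ ∧
            ‖u₁ t - u₂ t‖ ≤ L₁ ^ m * ‖u₀₁ - u₀₂‖) := by
  obtain ⟨-, hwU, W, V, hwY, -, -, -, hwe⟩ := id hw
  obtain ⟨L, K, r, T₁, F⟩ :=
    LocalFrame.exists_localFrame hι_inj hT hU_open hA_lip hf_lip hwY hwU hw_mr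
  have hK : 0 < K := zero_lt_one.trans_le F.one_le_K
  have hr := F.r_pos
  have hR₀ : 0 < r / (8 * K) := by positivity
  have hL₁ : 1 ≤ 6 + 2 * K := by linarith
  have hex : ∀ t₀ t₁ : ℝ, 0 ≤ t₀ → t₀ < t₁ → t₁ ≤ T → t₁ ≤ t₀ + T₁ →
      ∀ u₀ ∈ Metric.closedBall (w t₀) (r / (8 * K)),
      ∃ u, IsStrictSolution ι p U A f g t₀ t₁ u₀ u := by
    intro t₀ t₁ h0 h1 h2 h3 u₀ hu₀
    rw [Metric.mem_closedBall, dist_eq_norm] at hu₀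
    exact F.exists_isStrictSolution hg hwY hwe h0 h1.le h2 h3 hu₀
  have hlip : ∀ t₀ t₁ : ℝ, 0 ≤ t₀ → t₀ < t₁ → t₁ ≤ T → t₁ ≤ t₀ + T₁ →
      ∀ u₀₁ ∈ Metric.closedBall (w t₀) (r / (8 * K)),
      ∀ u₀₂ ∈ Metric.closedBall (w t₀) (r / (8 * K)),
      ∀ u₁ u₂ : ℝ → TraceSpace ι p, IsStrictSolution ι p U A f g t₀ t₁ u₀₁ u₁ →
      IsStrictSolution ι p U A f g t₀ t₁ u₀₂ u₂ →
      ∀ t ∈ Icc t₀ t₁, ‖u₁ t - u₂ t‖ ≤ (6 + 2 * K) * ‖u₀₁ - u₀₂‖ := by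
    intro t₀ t₁ h0 h1 h2 h3 u₀₁ hu₀₁ u₀₂ hu₀₂ u₁ u₂ hs₁ hs₂ t ht
    rw [Metric.mem_closedBall, dist_eq_norm] at hu₀₁ hu₀₂
    exact F.norm_sub_le hwY hwe h0 h1.le h2 h3 hu₀₁ hu₀₂ hs₁ hs₂ ht
  refine ⟨r / (8 * K), T₁, 6 + 2 * K, hR₀, F.T₁_pos, F.T₁_le, hL₁, fun t ht => ?_,
    fun t₀ t₁ h0 h1 h2 h3 => ⟨fun u₀ hu₀ => ?_, hlip t₀ t₁ h0 h1 h2 h3⟩, ?_⟩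
  · refine (Metric.closedBall_subset_closedBall ?_).trans (F.ball t ht)
    exact (div_le_self hr.le (by linarith [F.one_le_K])).trans (by linarith)
  · obtain ⟨u, hu⟩ := hex t₀ t₁ h0 h1 h2 h3 u₀ hu₀
    -- Uniqueness is the Lipschitz estimate for equal initial values.
    refine ⟨u, hu, fun u' hu' t ht => ?_⟩
    have := hlip t₀ t₁ h0 h1 h2 h3 u₀ hu₀ u₀ hu₀ u' u hu' hu t ht
    rw [sub_self, norm_zero, mul_zero] at this
    exact sub_eq_zero.1 (norm_le_zero_iff.1 this)
  · intro m hm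
    have hmT : ∀ t₀ : ℝ, 0 ≤ t₀ → T - t₀ ≤ m * T₁ := by
      intro t₀ ht₀
      have h1 : T / T₁ ≤ m := hm ▸ Nat.le_ceil _
      rw [div_le_iff₀ F.T₁_pos] at h1
      linarith
    have hglob := norm_sub_le_of_local hw hR₀ F.T₁_pos hL₁ hlip m
    have hpow : 0 < (6 + 2 * K) ^ m := by positivity
    -- The global Lipschitz estimate against `w` itself: the factor `(6 + 2 * K) ^ m` cancels the
    -- denominator of the initial radius.
    have hstay : ∀ t₀ ∈ Ico 0 T, ∀ x ∈ Metric.closedBall (w t₀) (r / (8 * K) / (6 + 2 * K) ^ m),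
        ∀ u, IsStrictSolution ι p U A f g t₀ T x u →
        ∀ t ∈ Icc t₀ T, u t ∈ Metric.closedBall (w t) (r / (8 * K)) := by
      intro t₀ ht₀ x hx u hu t ht
      have h1 := hglob t₀ ht₀.1 ht₀.2 (hmT t₀ ht₀.1) x hx (w t₀)
        (Metric.mem_closedBall_self (by positivity)) u w hu
        (hw.mono (Icc_subset_Icc_left ht₀.1)) t ht
      rw [Metric.mem_closedBall, dist_eq_norm] at hx ⊢
      refine h1.trans ((mul_le_mul_of_nonneg_left hx hpow.le).trans_eq ?_)
      field_simp
    refine ⟨fun t₀ ht₀ u₀ hu₀ => ?_, fun t₀ ht₀ u₀₁ hu₀₁ u₀₂ hu₀₂ u₁ u₂ hu₁ hu₂ t ht =>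
      ⟨hstay t₀ ht₀ _ hu₀₁ _ hu₁ t ht, hstay t₀ ht₀ _ hu₀₂ _ hu₂ t ht,
        hglob t₀ ht₀.1 ht₀.2 (hmT t₀ ht₀.1) _ hu₀₁ _ hu₀₂ u₁ u₂ hu₁ hu₂ t ht⟩⟩
    obtain ⟨u, hu⟩ := exists_isStrictSolution_of_local hw hR₀ F.T₁_pos hL₁ hex hlip m t₀ ht₀.1
      ht₀.2 (hmT t₀ ht₀.1) u₀ hu₀
    refine ⟨u, hu, hu.continuousOn, hstay t₀ ht₀ u₀ hu₀ u hu, fun u' hu' t ht => ?_⟩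
    have := hglob t₀ ht₀.1 ht₀.2 (hmT t₀ ht₀.1) u₀ hu₀ u₀ hu₀ u' u hu' hu t ht
    rw [sub_self, norm_zero, mul_zero] at this
    exact sub_eq_zero.1 (norm_le_zero_iff.1 this)
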